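/- Let $(N,c,D)$ be a Weyl space, $\dim N=n$ (that is, $c$ is a conformal structure on the smooth manifold $N$ and $D$ is a torsion free connection preserving $c$), and let $1\le r<\tfrac12 n$. Let $\pi:Q_{N,r}\to N$ be the bundle of complex $r$-dimensional isotropic subspaces of $(T^{\mathbb C}N,c)$. The fibres of $\pi$ are complex submanifolds of Grassmannians, and $D$ induces a connection $\mathscr H\subseteq TQ_{N,r}$. Let $\mathcal J'_{N,r}$ be the almost CR-structure on $Q_{N,r}$ whose eigenbundle corresponding to $-\mathrm i$ is $\mathscr G_0\oplus(\ker d\pi)^{1,0}$, where $\mathscr G_0\subseteq\mathscr H^{\mathbb C}$ is characterised by $d\pi\bigl((\mathscr G_0)_q\bigr)=q$ for any $q\in Q_{N,r}$. Let $M\subseteq N$ be a submanifold, $\dim M=2r$, with inclusion $\iota$, let $c_M=c|_M$, and let $D^M$ be the connection on $M$ induced by $D$ (the tangential part of $D$), which is a Weyl connection on $(M,c_M)$. Let $p$ be a smooth section over $M$ of $Q_{N,r}$ which is tangent to $M$, that is, $p_x\subseteq T^{\mathbb C}_xM$ for any $x\in M$. Denote by $J^p$ the almost Hermitian structure on $(M,c_M)$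 whose eigenbundle corresponding to $-\mathrm i$ is $p$, and suppose $M$ oriented such that $J^p$ is positive. Let $Q_M$ be the bundle of positive maximal isotropic spaces on $(M,c_M)$ (the eigenspaces corresponding to $-\mathrm i$ of the positive orthogonal complex structures), so that $p$ is also a section of $Q_M$, and let $\mathcal J'_M$ be the almost complex structure on $Q_M$ whose eigenbundle corresponding to $-\mathrm i$ is defined, as above, by using $D^M$. A map from $(M,J^p)$ to a manifold endowed with an almost CR-structure is called holomorphic if its differential maps the eigenbundle of $J^p$ corresponding to $-\mathrm i$ into the eigenbundle of the almost CR-structure corresponding to $-\mathrm i$. Also, $(M,J^p)$ is called $(1,1)$-geodesic if the $(1,1)$-part, with respect to $J^p$, of the second fundamental form $b(X,Y)=D_XY-D^M_XY$ is zero; that is, $b(X,Y)+b(J^pX,J^pY)=0$ for any $X,Y\in TM$. Then the following assertions are equivalent: (i) $p:(M,J^p)\to(Q_{N,r},\mathcal J'_{N,r})$ is holomorphic. (ii) $(M,J^p)$ is a $(1,1)$-geodesic submanifold of $(N,c,D)$ and $p:(M,J^p)\to(Q_M,\mathcal J'_M)$ is holomorphic. -/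

import Mathlib

open Bundle FiberBundle
open scoped Manifold ContDiff Topology TensorProduct

noncomputable section

set_option linter.unusedSectionVars false

namespace WeylTwistor

section LinearAlgebra

variable {V W : Type*} [AddCommGroup V] [Module ℝ V] [TopologicalSpace V]
  [AddCommGroup W] [Module ℝ W] [TopologicalSpace W]

/-- The complex-linear extension `ℂ ⊗ V → ℂ ⊗ W` of a real-linear map. -/
def cx (f : V →L[ℝ] W) : ℂ ⊗[ℝ] V →ₗ[ℂ] ℂ ⊗[ℝ] W :=
  (f : V →ₗ[ℝ] W).baseChange ℂ

/-- The eigenspace, corresponding to `-i`, of the complexification of a real endomorphism. -/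
def minusI (F : V →L[ℝ] V) : Submodule ℂ (ℂ ⊗[ℝ] V) :=
  Module.End.eigenspace (cx F) (-Complex.I)

/-- `A` is skew-adjoint with respect to the conformal class of bilinear forms `c`. -/
def IsSkew (c : Set (V →L[ℝ] V →L[ℝ] ℝ)) (A : V →L[ℝ] V) : Prop :=
  ∀ b ∈ c, ∀ v w, b (A v) w + b v (A w) = 0

/-- A complex subspace of `ℂ ⊗ V` is isotropic if the complex-bilinear extensions of the
forms in the conformal class `c` vanish on it. -/
def IsIsotropic (c : Set (V →L[ℝ] V →L[ℝ] ℝ)) (q : Submodule ℂ (ℂ ⊗[ℝ] V)) : Prop :=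
  ∀ b ∈ c, ∀ v ∈ q, ∀ w ∈ q,
    LinearMap.BilinForm.baseChange ℂ (ContinuousLinearMap.toBilinForm b) v w = 0

/-- `F` is the skew-adjoint `f`-structure on `(V, c)` whose eigenspace corresponding to `-i`
is `q`. -/
def IsFStructureOf (c : Set (V →L[ℝ] V →L[ℝ] ℝ)) (q : Submodule ℂ (ℂ ⊗[ℝ] V))
    (F : V →L[ℝ] V) : Prop :=
  IsSkew c F ∧ (∀ v, F (F (F v)) + F v = 0) ∧ minusI F = q

open Classical in
/-- The skew-adjoint `f`-structure on `(V, c)` whose eigenspace corresponding to `-i` is the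
isotropic space `q`; it exists and is unique by `existsUnique_isFStructureOf`. -/
def fStructure (c : Set (V →L[ℝ] V →L[ℝ] ℝ)) (q : Submodule ℂ (ℂ ⊗[ℝ] V)) : V →L[ℝ] V :=
  if h : ∃ F, IsFStructureOf c q F then h.choose else 0

/-- `c` consists of the positive multiples of one inner product. -/
def IsConformalClass (c : Set (V →L[ℝ] V →L[ℝ] ℝ)) : Prop :=
  ∃ g : V →L[ℝ] V →L[ℝ] ℝ, (∀ v w, g v w = g w v) ∧ (∀ v, v ≠ 0 → 0 < g v v) ∧
    c = {b | ∃ t : ℝ, 0 < t ∧ b = t • g}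

/-- Orthogonal projection on a subspace, given as the image of an injective linear map. -/
theorem exists_orthogonal_projection {U : Type*} [AddCommGroup U] [Module ℝ U]
    [FiniteDimensional ℝ U] (g : V →L[ℝ] V →L[ℝ] ℝ) (hs : ∀ v w, g v w = g w v)
    (hp : ∀ v, v ≠ 0 → 0 < g v v) (L : U →ₗ[ℝ] V) (hL : Function.Injective L) :
    ∃ P : V →ₗ[ℝ] U, (∀ u, P (L u) = u) ∧ ∀ w u, g (w - L (P w)) (L u) = 0 := by
  let h : LinearMap.BilinForm ℝ U := (ContinuousLinearMap.toBilinForm g).comp L L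
  have hh : ∀ u u', h u u' = g (L u) (L u') := fun u u' => rfl
  have hnd : h.Nondegenerate := by
    have key : ∀ u, (∀ u', g (L u) (L u') = 0) → u = 0 := by
      intro u hu
      by_contra hne
      have : L u ≠ 0 := fun h0 => hne (hL (by simpa using h0))
      exact (hp _ this).ne' (hu u)
    refine ⟨fun u hu => key u hu, fun u hu => key u fun u' => ?_⟩
    rw [hs]; exact hu u'
  let e := LinearMap.BilinForm.toDual h hnd
  let T : V →ₗ[ℝ] Module.Dual ℝ U :=
    (LinearMap.compl₂ (ContinuousLinearMap.toBilinForm g) L)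
  refine ⟨e.symm.toLinearMap ∘ₗ T, fun u => ?_, fun w u => ?_⟩
  · apply e.injective
    ext u'
    simp [T, e, LinearMap.BilinForm.toDual_def, hh]
  · have h1 : e (e.symm (T w)) u = T w u := by rw [LinearEquiv.apply_symm_apply]
    rw [LinearMap.BilinForm.toDual_def, hh] at h1
    have h2 : T w u = g w (L u) := rfl
    simp only [map_sub, sub_apply, LinearMap.comp_apply,
      LinearEquiv.coe_coe]
    rw [h1, h2, sub_self]

/-- Real part of a complexified vector. -/
def reV : ℂ ⊗[ℝ] V →ₗ[ℝ] V :=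
  (TensorProduct.lid ℝ V).toLinearMap ∘ₗ LinearMap.rTensor V Complex.reLm

/-- Imaginary part of a complexified vector. -/
def imV : ℂ ⊗[ℝ] V →ₗ[ℝ] V :=
  (TensorProduct.lid ℝ V).toLinearMap ∘ₗ LinearMap.rTensor V Complex.imLm

@[simp] theorem reV_tmul (z : ℂ) (v : V) : reV (z ⊗ₜ[ℝ] v) = z.re • v := by simp [reV]
@[simp] theorem imV_tmul (z : ℂ) (v : V) : imV (z ⊗ₜ[ℝ] v) = z.im • v := by simp [imV]

theorem reV_add_imV (z : ℂ ⊗[ℝ] V) :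
    (1 : ℂ) ⊗ₜ[ℝ] reV z + Complex.I ⊗ₜ[ℝ] imV z = z := by
  induction z with
  | zero => simp
  | tmul a v =>
    rw [reV_tmul, imV_tmul, ← TensorProduct.smul_tmul, ← TensorProduct.smul_tmul,
      ← TensorProduct.add_tmul]
    congr 1
    apply Complex.ext <;> simp
  | add x y hx hy =>
    rw [map_add, map_add, TensorProduct.tmul_add, TensorProduct.tmul_add]
    nth_rewrite 3 [← hx]
    nth_rewrite 3 [← hy]
    abel

theorem reV_I_smul (z : ℂ ⊗[ℝ] V) : reV (Complex.I • z) = - imV z := by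
  induction z with
  | zero => simp
  | tmul a v => simp [TensorProduct.smul_tmul']
  | add x y hx hy => rw [smul_add, map_add, map_add, hx, hy]; abel

theorem imV_I_smul (z : ℂ ⊗[ℝ] V) : imV (Complex.I • z) = reV z := by
  induction z with
  | zero => simp
  | tmul a v => simp [TensorProduct.smul_tmul']
  | add x y hx hy => rw [smul_add, map_add, map_add, hx, hy]

theorem ext_reV_imV {z w : ℂ ⊗[ℝ] V} (h1 : reV z = reV w) (h2 : imV z = imV w) : z = w := by
  rw [← reV_add_imV z, ← reV_add_imV w, h1, h2]

theorem reV_cx (f : V →L[ℝ] W) (z : ℂ ⊗[ℝ] V) : reV (cx f z) = f (reV z) := by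
  induction z with
  | zero => simp
  | tmul a v => simp [cx]
  | add x y hx hy => simp only [map_add, hx, hy]

theorem imV_cx (f : V →L[ℝ] W) (z : ℂ ⊗[ℝ] V) : imV (cx f z) = f (imV z) := by
  induction z with
  | zero => simp
  | tmul a v => simp [cx]
  | add x y hx hy => simp only [map_add, hx, hy]

theorem mem_minusI {F : V →L[ℝ] V} {z : ℂ ⊗[ℝ] V} :
    z ∈ minusI F ↔ F (reV z) = imV z ∧ F (imV z) = - reV z := by
  rw [minusI, Module.End.mem_eigenspace_iff]
  constructor
  · intro h
    refine ⟨?_, ?_⟩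
    · rw [← reV_cx, h, neg_smul, map_neg, reV_I_smul, neg_neg]
    · rw [← imV_cx, h, neg_smul, map_neg, imV_I_smul]
  · rintro ⟨h1, h2⟩
    apply ext_reV_imV
    · rw [reV_cx, h1, neg_smul, map_neg, reV_I_smul, neg_neg]
    · rw [imV_cx, h2, neg_smul, map_neg, imV_I_smul]

theorem baseChange_re_im (b : V →L[ℝ] V →L[ℝ] ℝ) (z w : ℂ ⊗[ℝ] V) :
    LinearMap.BilinForm.baseChange ℂ (ContinuousLinearMap.toBilinForm b) z w =
      ((b (reV z) (reV w) - b (imV z) (imV w) : ℝ) : ℂ) +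
        ((b (reV z) (imV w) + b (imV z) (reV w) : ℝ) : ℂ) * Complex.I := by
  conv_lhs => rw [← reV_add_imV z, ← reV_add_imV w]
  simp only [map_add, LinearMap.add_apply, LinearMap.BilinForm.baseChange_tmul]
  simp
  ring

/-- On a finite dimensional conformal vector space, each isotropic space is the eigenspace
corresponding to `-i` of exactly one skew-adjoint `f`-structure. -/
theorem existsUnique_isFStructureOf [IsTopologicalAddGroup V] [ContinuousSMul ℝ V] [T2Space V]
    [FiniteDimensional ℝ V] {c : Set (V →L[ℝ] V →L[ℝ] ℝ)} (hc : IsConformalClass c)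
    {q : Submodule ℂ (ℂ ⊗[ℝ] V)} (hq : IsIsotropic c q) :
    ∃! F, IsFStructureOf c q F := by
  obtain ⟨g, hs, hp, rfl⟩ := hc
  have hgc : g ∈ {b | ∃ t : ℝ, 0 < t ∧ b = t • g} := ⟨1, one_pos, (one_smul _ _).symm⟩
  have hiso : ∀ z ∈ q, ∀ w ∈ q, g (reV z) (reV w) = g (imV z) (imV w) ∧
      g (reV z) (imV w) + g (imV z) (reV w) = 0 := by
    intro z hz w hw
    have h := hq g hgc z hz w hw
    rw [baseChange_re_im] at h
    have h1 := congrArg Complex.re h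
    have h2 := congrArg Complex.im h
    simp at h1 h2
    exact ⟨by linarith, by linarith⟩
  let qR : Submodule ℝ (ℂ ⊗[ℝ] V) := q.restrictScalars ℝ
  have : FiniteDimensional ℝ (ℂ ⊗[ℝ] V) := inferInstance
  let ρ : qR →ₗ[ℝ] V := reV ∘ₗ qR.subtype
  have hρ : Function.Injective ρ := by
    rw [injective_iff_map_eq_zero]
    rintro ⟨z, hz⟩ h0
    have h0' : reV z = 0 := h0
    have h1 := (hiso z hz z hz).1
    rw [h0'] at h1
    have h2 : imV z = 0 := by
      by_contra hne
      exact (hp _ hne).ne (by simpa using h1)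
    exact Subtype.ext (ext_reV_imV (by simpa using h0') (by simpa using h2))
  obtain ⟨P, hP1, hP2⟩ := exists_orthogonal_projection g hs hp ρ hρ
  have hP1' : ∀ z, ∀ hz : z ∈ q, P (reV z) = ⟨z, hz⟩ := fun z hz => hP1 ⟨z, hz⟩
  have hImem : ∀ z ∈ q, Complex.I • z ∈ q := fun z hz => q.smul_mem _ hz
  have him : ∀ z ∈ q, imV z = reV (-(Complex.I • z)) := by
    intro z hz; rw [map_neg, reV_I_smul, neg_neg]
  have hPm : ∀ v, ((P v : ℂ ⊗[ℝ] V)) ∈ q := fun v => (P v).2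
  have horth : ∀ v, ∀ z ∈ q, g v (reV z) = g (reV (P v : ℂ ⊗[ℝ] V)) (reV z) := by
    intro v z hz
    have := hP2 v ⟨z, hz⟩
    rw [map_sub, sub_apply, sub_eq_zero] at this
    exact this
  have horth' : ∀ v, ∀ z ∈ q, g v (imV z) = g (reV (P v : ℂ ⊗[ℝ] V)) (imV z) := by
    intro v z hz
    rw [him z hz]
    exact horth v _ (q.neg_mem (hImem z hz))
  let F₀ : V →ₗ[ℝ] V := imV ∘ₗ qR.subtype ∘ₗ P
  have hF₀ : ∀ v, F₀ v = imV (P v : ℂ ⊗[ℝ] V) := fun v => rfl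
  have hF₀q : ∀ z ∈ q, F₀ (reV z) = imV z ∧ F₀ (imV z) = - reV z := by
    intro z hz
    constructor
    · rw [hF₀, hP1' z hz]
    · have hm : -(Complex.I • z) ∈ q := q.neg_mem (hImem z hz)
      rw [him z hz, hF₀, hP1' _ hm]
      simp [imV_I_smul]
  let F : V →L[ℝ] V := LinearMap.toContinuousLinearMap F₀
  have hF : ∀ v, F v = F₀ v := fun v => rfl
  refine ⟨F, ⟨?_, ?_, ?_⟩, ?_⟩
  · rintro b ⟨t, ht, rfl⟩ v w
    have h1 : g (F v) w = g (imV (P v : ℂ ⊗[ℝ] V)) (reV (P w : ℂ ⊗[ℝ] V)) := by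
      rw [hF, hF₀, hs, horth' w _ (hPm v), hs]
    have h2 : g v (F w) = g (reV (P v : ℂ ⊗[ℝ] V)) (imV (P w : ℂ ⊗[ℝ] V)) := by
      rw [hF, hF₀, horth' v _ (hPm w)]
    have h3 := (hiso _ (hPm v) _ (hPm w)).2
    simp only [smul_apply, smul_eq_mul]
    rw [h1, h2, ← mul_add, add_comm, h3, mul_zero]
  · intro v
    simp only [hF]
    rw [hF₀ v, (hF₀q _ (hPm v)).2, map_neg, (hF₀q _ (hPm v)).1]
    abel
  · ext z
    rw [mem_minusI]
    constructor
    · rintro ⟨h1, h2⟩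
      have hm : Complex.I • (P (imV z) : ℂ ⊗[ℝ] V) ∈ q := hImem _ (hPm _)
      have hre : reV z = reV (Complex.I • (P (imV z) : ℂ ⊗[ℝ] V)) := by
        rw [reV_I_smul, ← hF₀, ← hF, h2, neg_neg]
      have him' : imV z = imV (Complex.I • (P (imV z) : ℂ ⊗[ℝ] V)) := by
        have h3 := (hF₀q _ hm).1
        rw [← hre] at h3
        exact h1.symm.trans h3
      rw [ext_reV_imV hre him']
      exact hm
    · intro hz
      exact hF₀q z hz
  · rintro G ⟨hG1, hG2, hG3⟩
    have hGq : ∀ z ∈ q, G (reV z) = imV z := by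
      intro z hz
      rw [← hG3, mem_minusI] at hz
      exact hz.1
    have hGm : ∀ v, ∃ z ∈ q, reV z = G (G v) := by
      intro v
      refine ⟨(1 : ℂ) ⊗ₜ[ℝ] (G (G v)) - Complex.I ⊗ₜ[ℝ] (G v), ?_, by simp⟩
      rw [← hG3, mem_minusI]
      simp
      exact eq_neg_of_add_eq_zero_left (hG2 v)
    ext v
    have hn : G (v - reV (P v : ℂ ⊗[ℝ] V)) = 0 := by
      by_contra hne
      set n := v - reV (P v : ℂ ⊗[ℝ] V) with hn
      have h1 := hG1 g hgc n (G n)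
      obtain ⟨z, hz, hz'⟩ := hGm n
      have h2 : g n (G (G n)) = 0 := by
        rw [← hz', hn]
        exact hP2 v ⟨z, hz⟩
      rw [h2, add_zero] at h1
      exact (hp _ hne).ne' h1
    rw [map_sub, sub_eq_zero] at hn
    rw [hn, hGq _ (hPm v), hF, hF₀]

theorem fStructure_spec [IsTopologicalAddGroup V] [ContinuousSMul ℝ V] [T2Space V]
    [FiniteDimensional ℝ V] {c : Set (V →L[ℝ] V →L[ℝ] ℝ)} (hc : IsConformalClass c)
    {q : Submodule ℂ (ℂ ⊗[ℝ] V)} (hq : IsIsotropic c q) :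
    IsFStructureOf c q (fStructure c q) := by
  have h := (existsUnique_isFStructureOf hc hq).exists
  rw [fStructure, dif_pos h]
  exact h.choose_spec

end LinearAlgebra

section Manifolds

variable {E : Type*} [NormedAddCommGroup E] [NormedSpace ℝ E] [FiniteDimensional ℝ E]
  {B : Type*} [TopologicalSpace B] [ChartedSpace E B] [IsManifold 𝓘(ℝ, E) ∞ B]

instance (x : B) : FiniteDimensional ℝ (TangentSpace 𝓘(ℝ, E) x) :=
  inferInstanceAs (FiniteDimensional ℝ E)

instance (x : B) : T2Space (TangentSpace 𝓘(ℝ, E) x) :=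
  inferInstanceAs (T2Space E)

variable (E B) in
/-- The total space of the vector bundle `End(TB)`, a smooth manifold. -/
abbrev EndTotal : Type _ :=
  TotalSpace (E →L[ℝ] E) (fun x : B => TangentSpace 𝓘(ℝ, E) x →L[ℝ] TangentSpace 𝓘(ℝ, E) x)

/-- The model with corners of the manifold `End(TB)`. -/
abbrev endModel (E : Type*) [NormedAddCommGroup E] [NormedSpace ℝ E] :
    ModelWithCorners ℝ (E × (E →L[ℝ] E)) (ModelProd E (E →L[ℝ] E)) :=
  (𝓘(ℝ, E)).prod 𝓘(ℝ, E →L[ℝ] E)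

variable (E B) in
/-- A Weyl space: a conformal structure (in each tangent space, the ray of positive multiples of
a smooth Riemannian metric) and a smooth torsion free connection which preserves it: for each
metric `g` in the conformal class, `D g = α ⊗ g` for some `1`-form `α`. -/
structure WeylSpace where
  conf : ∀ x : B, Set (TangentSpace 𝓘(ℝ, E) x →L[ℝ] TangentSpace 𝓘(ℝ, E) x →L[ℝ] ℝ)
  exists_metric : ∃ g : ContMDiffRiemannianMetric 𝓘(ℝ, E) ∞ E (fun x : B => TangentSpace 𝓘(ℝ, E) x),
    ∀ x, conf x = {b | ∃ t : ℝ, 0 < t ∧ b = t • g.inner x}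
  conn : CovariantDerivative 𝓘(ℝ, E) E (fun x : B => TangentSpace 𝓘(ℝ, E) x)
  smooth_conn : CovariantDerivative.ContMDiffCovariantDerivative conn ∞
  torsion_free : conn.torsion = 0
  conformal : ∀ g : ContMDiffRiemannianMetric 𝓘(ℝ, E) ∞ E (fun x : B => TangentSpace 𝓘(ℝ, E) x),
    (∀ x, g.inner x ∈ conf x) →
    ∃ α : ∀ x : B, TangentSpace 𝓘(ℝ, E) x →L[ℝ] ℝ, ∀ (x : B) (Y Z : ∀ y : B, TangentSpace 𝓘(ℝ, E) y) (X : TangentSpace 𝓘(ℝ, E) x),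
      MDiffAt (T% Y) x → MDiffAt (T% Z) x →
      mvfderiv 𝓘(ℝ, E) (fun y => g.inner y (Y y) (Z y)) x X =
        α x X * g.inner x (Y x) (Z x) + g.inner x (conn Y x X) (Z x)
          + g.inner x (Y x) (conn Z x X)

theorem WeylSpace.isConformalClass (S : WeylSpace E B) (x : B) : IsConformalClass (S.conf x) := by
  obtain ⟨g, hg⟩ := S.exists_metric
  exact ⟨g.inner x, g.symm x, g.pos x, hg x⟩

/-! ### The bundle of isotropic spaces and its almost CR-structure

The bundle of isotropic spaces of a conformal manifold `(B, c)` is regarded as a submanifold of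
`End(TB)`, by identifying an isotropic space `q` on `(T_x B, c)` with the skew-adjoint
`f`-structure whose eigenspace corresponding to `-i` is `q`. -/

/-- The point of `End(TB)` corresponding to an isotropic space at `x`. -/
def isoPoint (c : ∀ x : B, Set (TangentSpace 𝓘(ℝ, E) x →L[ℝ] TangentSpace 𝓘(ℝ, E) x →L[ℝ] ℝ)) (x : B)
    (q : Submodule ℂ (ℂ ⊗[ℝ] TangentSpace 𝓘(ℝ, E) x)) : EndTotal E B :=
  ⟨x, fStructure (c x) q⟩

/-- The horizontal space at `z ∈ End(TB)` of the connection induced by `D`: it is formed of the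
derivatives `dσ(X)` of the sections `σ` of `End(TB)` through `z` with `D_X σ = 0`, where
`(D_X σ) Y = D_X (σ Y) - σ (D_X Y)`. -/
def horizontal (D : CovariantDerivative 𝓘(ℝ, E) E (fun x : B => TangentSpace 𝓘(ℝ, E) x)) (z : EndTotal E B) :
    Submodule ℝ (TangentSpace (endModel E) z) :=
  Submodule.span ℝ {ξ | ∃ (σ : ∀ y : B, TangentSpace 𝓘(ℝ, E) y →L[ℝ] TangentSpace 𝓘(ℝ, E) y) (X : TangentSpace 𝓘(ℝ, E) z.1),
    σ z.1 = z.2 ∧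
    MDifferentiableAt 𝓘(ℝ, E) (endModel E) (fun y => (⟨y, σ y⟩ : EndTotal E B)) z.1 ∧
    (∀ Y : ∀ y : B, TangentSpace 𝓘(ℝ, E) y, MDiffAt (T% Y) z.1 →
      D (fun y => σ y (Y y)) z.1 X = σ z.1 (D Y z.1 X)) ∧
    ξ = mfderiv 𝓘(ℝ, E) (endModel E) (fun y => (⟨y, σ y⟩ : EndTotal E B)) z.1 X}

/-- The tangent vector at `t = 0` of the curve `t ↦ F + t Φ` in the fibre `End(T_x B)`. -/
def vertLift (z : EndTotal E B) (Φ : TangentSpace 𝓘(ℝ, E) z.1 →L[ℝ] TangentSpace 𝓘(ℝ, E) z.1) :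
    TangentSpace (endModel E) z :=
  mfderiv 𝓘(ℝ, ℝ) (endModel E) (fun t : ℝ => (⟨z.1, z.2 + t • Φ⟩ : EndTotal E B)) 0 (1 : ℝ)

end Manifolds

section LinearAlgebra

variable {V : Type*} [AddCommGroup V] [Module ℝ V] [TopologicalSpace V]

/-- The tangent space at `F` of the space of isotropic spaces of a given dimension on `(V, c)`,
viewed as skew-adjoint `f`-structures. The orthogonal group acts transitively on it, by
conjugation, and so its tangent space is formed of the commutators `[A, F]`, with `A`
skew-adjoint. -/
def fibreTangent (c : Set (V →L[ℝ] V →L[ℝ] ℝ)) (F : V →L[ℝ] V) : Set (V →L[ℝ] V) :=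
  {Φ | ∃ A, IsSkew c A ∧ ∀ v, Φ v = A (F v) - F (A v)}

/-- `δ ∈ Hom(q, (ℂ ⊗ V) / q)` is the derivative, in the direction `Φ`, of the map
`F ↦ q = ker (F + i)` with values in the Grassmannian of `ℂ ⊗ V`. (If `v(t)` is a curve with
`(F(t) + i) v(t) = 0` then the derivative maps `v(0)` to the class of `w = v'(0)`, and
`(F + i) w = - Φ v`.) -/
def IsPlaneVelocity (F Φ : V →L[ℝ] V)
    (δ : minusI F →ₗ[ℂ] (ℂ ⊗[ℝ] V) ⧸ minusI F) : Prop :=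
  ∀ (v : minusI F) (w : ℂ ⊗[ℝ] V), (minusI F).mkQ w = δ v →
    cx F w + Complex.I • w = - cx Φ v

/-- `Ψ = 𝒥 Φ`, where `𝒥` is the complex structure on the tangent space at `F` of the space of
isotropic spaces, induced from the Grassmannian of `ℂ ⊗ V`. -/
def IsTimesI (F Φ Ψ : V →L[ℝ] V) : Prop :=
  ∃ δ, IsPlaneVelocity F Φ δ ∧ IsPlaneVelocity F Ψ (Complex.I • δ)

end LinearAlgebra

section Manifolds

variable {E : Type*} [NormedAddCommGroup E] [NormedSpace ℝ E] [FiniteDimensional ℝ E]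
  {B : Type*} [TopologicalSpace B] [ChartedSpace E B] [IsManifold 𝓘(ℝ, E) ∞ B]

/-- The space `(ker dπ)^{1,0}` at a point of the bundle of isotropic spaces: it is spanned by the
vectors `ξ - i 𝒥 ξ`, with `ξ` tangent to the fibre. -/
def vert10 (c : ∀ x : B, Set (TangentSpace 𝓘(ℝ, E) x →L[ℝ] TangentSpace 𝓘(ℝ, E) x →L[ℝ] ℝ)) (z : EndTotal E B) :
    Submodule ℂ (ℂ ⊗[ℝ] TangentSpace (endModel E) z) :=
  Submodule.span ℂ {ζ | ∃ Φ ∈ fibreTangent (c z.1) z.2, ∃ Ψ ∈ fibreTangent (c z.1) z.2,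
    IsTimesI z.2 Φ Ψ ∧
    ζ = (1 : ℂ) ⊗ₜ[ℝ] vertLift z Φ - Complex.I ⊗ₜ[ℝ] vertLift z Ψ}

/-- The space `𝒢₀` of complexified horizontal vectors at `z` which are projected, by `dπ`, to the
isotropic space `q = ker (F + i)` corresponding to `z`. -/
def horizG0 (D : CovariantDerivative 𝓘(ℝ, E) E (fun x : B => TangentSpace 𝓘(ℝ, E) x)) (z : EndTotal E B) :
    Submodule ℂ (ℂ ⊗[ℝ] TangentSpace (endModel E) z) :=
  (horizontal D z).baseChange ℂ ⊓
    (minusI z.2).comap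
      (cx (mfderiv (endModel E) 𝓘(ℝ, E) (fun w : EndTotal E B => w.1) z))

/-- The complex distribution `𝒢' = 𝒢₀ ⊕ (ker dπ)^{1,0}` on the bundle of isotropic spaces, that
is, the eigenbundle corresponding to `-i` of the almost CR-structure `𝒥'`. -/
def distG' (c : ∀ x : B, Set (TangentSpace 𝓘(ℝ, E) x →L[ℝ] TangentSpace 𝓘(ℝ, E) x →L[ℝ] ℝ))
    (D : CovariantDerivative 𝓘(ℝ, E) E (fun x : B => TangentSpace 𝓘(ℝ, E) x)) (z : EndTotal E B) :
    Submodule ℂ (ℂ ⊗[ℝ] TangentSpace (endModel E) z) :=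
  horizG0 D z ⊔ vert10 c z

/-- A map `f` from a manifold endowed with an almost complex structure `J` to a manifold endowed
with an almost CR-structure, whose associated complex distribution (the eigenbundle corresponding
to `-i`) is `𝒢`, is holomorphic if `df` maps the eigenbundle of `J` corresponding to `-i`
into `𝒢`. -/
def IsHolomorphic {E' H' P : Type*} [NormedAddCommGroup E'] [NormedSpace ℝ E']
    [TopologicalSpace H'] (I' : ModelWithCorners ℝ E' H') [TopologicalSpace P]
    [ChartedSpace H' P] (J : ∀ x : B, TangentSpace 𝓘(ℝ, E) x →L[ℝ] TangentSpace 𝓘(ℝ, E) x) (f : B → P)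
    (𝒢 : ∀ z : P, Submodule ℂ (ℂ ⊗[ℝ] TangentSpace I' z)) : Prop :=
  ∀ x, (minusI (J x)).map (cx (mfderiv 𝓘(ℝ, E) I' f x)) ≤ 𝒢 (f x)

variable (E) in
/-- A field of orientations of the tangent spaces which is locally constant, that is, an
orientation of the manifold. -/
def IsOrientation {k : ℕ} (o : ∀ x : B, Orientation ℝ (TangentSpace 𝓘(ℝ, E) x) (Fin k)) : Prop :=
  ∀ (x : B) (b : Module.Basis (Fin k) ℝ (TangentSpace 𝓘(ℝ, E) x)), b.orientation = o x →
    ∀ᶠ y in 𝓝 x, ∀ b' : Module.Basis (Fin k) ℝ (TangentSpace 𝓘(ℝ, E) y),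
      (∀ i, b' i = extend E (b i) y) → b'.orientation = o y

end Manifolds

/-- A complex structure `J` on an oriented vector space is positive if the bases of the form
`(e₁, J e₁, …, e_r, J e_r)` are positive. -/
def IsPositive {V : Type*} [AddCommGroup V] [Module ℝ V] {r : ℕ}
    (o : Orientation ℝ V (Fin (2 * r))) (J : V → V) : Prop :=
  ∀ b : Module.Basis (Fin (2 * r)) ℝ V,
    (∀ k : Fin r, b ⟨2 * k + 1, by omega⟩ = J (b ⟨2 * k, by omega⟩)) → b.orientation = o

section Submanifolds

variable {E : Type*} [NormedAddCommGroup E] [NormedSpace ℝ E] [FiniteDimensional ℝ E]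
  {N : Type*} [TopologicalSpace N] [ChartedSpace E N] [IsManifold 𝓘(ℝ, E) ∞ N]
  {E' : Type*} [NormedAddCommGroup E'] [NormedSpace ℝ E'] [FiniteDimensional ℝ E']
  {M : Type*} [TopologicalSpace M] [ChartedSpace E' M] [IsManifold 𝓘(ℝ, E') ∞ M]

/-- The differential of a map `ι : M → N`. -/
abbrev dif (E E' : Type*) [NormedAddCommGroup E] [NormedSpace ℝ E] [NormedAddCommGroup E']
    [NormedSpace ℝ E'] {N M : Type*} [TopologicalSpace N] [ChartedSpace E N]
    [TopologicalSpace M] [ChartedSpace E' M] (ι : M → N) (x : M) : TangentSpace 𝓘(ℝ, E') x →L[ℝ] TangentSpace 𝓘(ℝ, E) (ι x) :=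
  mfderiv 𝓘(ℝ, E') 𝓘(ℝ, E) ι x

variable (E E') in
/-- `ι` is the inclusion of a submanifold (that is, an injective immersion). -/
structure IsSubmanifold (ι : M → N) : Prop where
  smooth : ContMDiff 𝓘(ℝ, E') 𝓘(ℝ, E) ∞ ι
  injective : Function.Injective ι
  immersive : ∀ x, Function.Injective (dif E E' ι x)

/-- The conformal structure `c|_M`. -/
def inducedConf (c : ∀ x : N, Set (TangentSpace 𝓘(ℝ, E) x →L[ℝ] TangentSpace 𝓘(ℝ, E) x →L[ℝ] ℝ)) (ι : M → N) (x : M) :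
    Set (TangentSpace 𝓘(ℝ, E') x →L[ℝ] TangentSpace 𝓘(ℝ, E') x →L[ℝ] ℝ) :=
  {b' | ∃ b ∈ c (ι x), ∀ v w, b' v w = b (dif E E' ι x v) (dif E E' ι x w)}

theorem exists_tangentialPart (S : WeylSpace E N) {ι : M → N} (hι : IsSubmanifold E E' ι)
    (x : M) : ∃ P : TangentSpace 𝓘(ℝ, E) (ι x) →L[ℝ] TangentSpace 𝓘(ℝ, E') x, (∀ u, P (dif E E' ι x u) = u) ∧
      ∀ b ∈ S.conf (ι x), ∀ w u, b (w - dif E E' ι x (P w)) (dif E E' ι x u) = 0 := by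
  obtain ⟨g, hs, hp, hc⟩ := S.isConformalClass (ι x)
  obtain ⟨P, h1, h2⟩ := exists_orthogonal_projection g hs hp (dif E E' ι x).toLinearMap
    (hι.immersive x)
  refine ⟨LinearMap.toContinuousLinearMap P, h1, ?_⟩
  rw [hc]
  rintro b ⟨t, ht, rfl⟩ w u
  have := h2 w u
  simp only [smul_apply, smul_eq_mul]
  exact mul_eq_zero_of_right _ this

/-- The tangential part `TN|_M → TM`, with respect to the conformal structure. -/
def tangentialPart (S : WeylSpace E N) {ι : M → N} (hι : IsSubmanifold E E' ι) (x : M) :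
    TangentSpace 𝓘(ℝ, E) (ι x) →L[ℝ] TangentSpace 𝓘(ℝ, E') x :=
  (exists_tangentialPart S hι x).choose

/-- The pull back, to the bundle `ι^*(TN)`, of a connection on `N`: in the local trivialization
of `TN` at `ι x`, if `V = ∑ Vⁱ eᵢ`, with `{eᵢ}` the corresponding local frame of `TN`, then
`D_X V = ∑ X(Vⁱ) eᵢ + Vⁱ(x) D_{dι(X)} eᵢ`. -/
def pullbackDeriv (D : CovariantDerivative 𝓘(ℝ, E) E (fun x : N => TangentSpace 𝓘(ℝ, E) x)) (ι : M → N)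
    (V : ∀ x : M, TangentSpace 𝓘(ℝ, E) (ι x)) (x : M) : TangentSpace 𝓘(ℝ, E') x →L[ℝ] TangentSpace 𝓘(ℝ, E) (ι x) :=
  let e := trivializationAt E (fun y : N => TangentSpace 𝓘(ℝ, E) y) (ι x)
  (e.symmL ℝ (ι x)) ∘L
      mvfderiv 𝓘(ℝ, E') (fun y => (e ⟨ι y, V y⟩).2) x +
    D (extend E (V x)) (ι x) ∘L dif E E' ι x


theorem extend_eq {x : N} (u : TangentSpace 𝓘(ℝ, E) x) {y : N}
    (hy : y ∈ (trivializationAt E (TangentSpace 𝓘(ℝ, E) : N → Type _) x).baseSet) :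
    extend E u y =
      (trivializationAt E (TangentSpace 𝓘(ℝ, E) : N → Type _) x).symmL ℝ y
        ((trivializationAt E (TangentSpace 𝓘(ℝ, E) : N → Type _) x).continuousLinearMapAt ℝ x
          u) := by
  have h : (trivializationAt E (TangentSpace 𝓘(ℝ, E) : N → Type _) x).continuousLinearMapAt ℝ x
      u = (trivializationAt E (TangentSpace 𝓘(ℝ, E) : N → Type _) x ⟨x, u⟩).2 := by
    rw [Trivialization.continuousLinearMapAt_apply, Trivialization.linearMapAt_apply,
      if_pos (FiberBundle.mem_baseSet_trivializationAt' x)]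
  rw [h, Trivialization.symmL_apply _ hy, extend]

theorem conn_extend_add (D : CovariantDerivative 𝓘(ℝ, E) E (fun x : N => TangentSpace 𝓘(ℝ, E) x))
    {x : N} (v w : TangentSpace 𝓘(ℝ, E) x) :
    D (extend E (v + w)) x = D (extend E v) x + D (extend E w) x := by
  have hv := mdifferentiableAt_extend 𝓘(ℝ, E) E v
  have hw := mdifferentiableAt_extend 𝓘(ℝ, E) E w
  rw [← D.isCovariantDerivativeOnUniv.add hv hw]
  refine D.isCovariantDerivativeOnUniv.congr_of_eventuallyEq (mdifferentiableAt_extend ..)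
    (mdifferentiableAt_add_section hv hw) Filter.univ_mem ?_
  filter_upwards [(trivializationAt E (TangentSpace 𝓘(ℝ, E) : N → Type _) x).open_baseSet.mem_nhds
    (FiberBundle.mem_baseSet_trivializationAt' x)] with y hy
  simp only [Pi.add_apply, extend_eq _ hy, map_add]

theorem conn_extend_smul
    (D : CovariantDerivative 𝓘(ℝ, E) E (fun x : N => TangentSpace 𝓘(ℝ, E) x))
    {x : N} (a : ℝ) (v : TangentSpace 𝓘(ℝ, E) x) :
    D (extend E (a • v)) x = a • D (extend E v) x := by
  have hv := mdifferentiableAt_extend 𝓘(ℝ, E) E v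
  rw [← D.isCovariantDerivativeOnUniv.smul_const a hv]
  refine D.isCovariantDerivativeOnUniv.congr_of_eventuallyEq (mdifferentiableAt_extend ..)
    (MDifferentiableAt.smul_section mdifferentiableAt_const hv) Filter.univ_mem ?_
  filter_upwards [(trivializationAt E (TangentSpace 𝓘(ℝ, E) : N → Type _) x).open_baseSet.mem_nhds
    (FiberBundle.mem_baseSet_trivializationAt' x)] with y hy
  simp only [Pi.smul_apply, extend_eq _ hy, map_smul]

section PullBack

variable {ι : M → N} {x : M}

theorem mdifferentiableAt_dif (hι : IsSubmanifold E E' ι)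
    {Y : ∀ x : M, TangentSpace 𝓘(ℝ, E') x} (hY : MDiffAt (T% Y) x) :
    MDifferentiableAt 𝓘(ℝ, E') (𝓘(ℝ, E).prod 𝓘(ℝ, E))
      (fun y => (⟨ι y, dif E E' ι y (Y y)⟩ : TangentBundle 𝓘(ℝ, E) N)) x := by
  have h1 : ContMDiff 𝓘(ℝ, E').tangent 𝓘(ℝ, E).tangent 1 (tangentMap 𝓘(ℝ, E') 𝓘(ℝ, E) ι) :=
    hι.smooth.contMDiff_tangentMap (by norm_cast)
  exact (h1.mdifferentiable one_ne_zero).mdifferentiableAt.comp x hY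

theorem mdifferentiableAt_coord (hι : IsSubmanifold E E' ι)
    {Y : ∀ x : M, TangentSpace 𝓘(ℝ, E') x} (hY : MDiffAt (T% Y) x) :
    MDifferentiableAt 𝓘(ℝ, E') 𝓘(ℝ, E)
      (fun y => (trivializationAt E (fun y : N => TangentSpace 𝓘(ℝ, E) y) (ι x)
        ⟨ι y, dif E E' ι y (Y y)⟩).2) x := by
  have h := mdifferentiableAt_dif hι hY
  rw [mdifferentiableAt_totalSpace] at h
  exact h.2

theorem eventually_baseSet (hι : IsSubmanifold E E' ι) (x : M) :
    ∀ᶠ y in 𝓝 x, ι y ∈ (trivializationAt E (fun y : N => TangentSpace 𝓘(ℝ, E) y)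
      (ι x)).baseSet :=
  hι.smooth.continuous.continuousAt.eventually
    ((trivializationAt E (fun y : N => TangentSpace 𝓘(ℝ, E) y) (ι x)).open_baseSet.mem_nhds
      (FiberBundle.mem_baseSet_trivializationAt' (ι x)))

theorem mvfderiv_congr {f g : M → E} (h : f =ᶠ[𝓝 x] g) :
    mvfderiv 𝓘(ℝ, E') f x = mvfderiv 𝓘(ℝ, E') g x := by
  ext X
  exact congrArg (fun L : TangentSpace 𝓘(ℝ, E') x →L[ℝ] E => L X) h.mfderiv_eq

theorem pullbackDeriv_add (hι : IsSubmanifold E E' ι)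
    (D : CovariantDerivative 𝓘(ℝ, E) E (fun x : N => TangentSpace 𝓘(ℝ, E) x))
    {Y Z : ∀ x : M, TangentSpace 𝓘(ℝ, E') x}
    (hY : MDiffAt (T% Y) x) (hZ : MDiffAt (T% Z) x) :
    (pullbackDeriv D ι (fun y => dif E E' ι y ((Y + Z) y)) x :
      TangentSpace 𝓘(ℝ, E') x →L[ℝ] TangentSpace 𝓘(ℝ, E) (ι x)) =
      pullbackDeriv D ι (fun y => dif E E' ι y (Y y)) x +
        pullbackDeriv D ι (fun y => dif E E' ι y (Z y)) x := by
  have h1 := mdifferentiableAt_coord hι hY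
  have h2 := mdifferentiableAt_coord hι hZ
  simp only [pullbackDeriv]
  have h3 : (fun y => (trivializationAt E (fun y : N => TangentSpace 𝓘(ℝ, E) y) (ι x)
        ⟨ι y, dif E E' ι y ((Y + Z) y)⟩).2) =ᶠ[𝓝 x]
      (fun y => (trivializationAt E (fun y : N => TangentSpace 𝓘(ℝ, E) y) (ι x)
        ⟨ι y, dif E E' ι y (Y y)⟩).2) + fun y => (trivializationAt E (fun y : N => TangentSpace 𝓘(ℝ, E) y) (ι x)
        ⟨ι y, dif E E' ι y (Z y)⟩).2 := by
    filter_upwards [eventually_baseSet hι x] with y hy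
    simp only [Pi.add_apply, map_add]
    exact ((trivializationAt E (fun y : N => TangentSpace 𝓘(ℝ, E) y) (ι x)).linear ℝ hy).map_add _ _
  have h4 : D (extend E (dif E E' ι x ((Y + Z) x))) (ι x) =
      D (extend E (dif E E' ι x (Y x))) (ι x) + D (extend E (dif E E' ι x (Z x))) (ι x) := by
    rw [Pi.add_apply, map_add, conn_extend_add]
  rw [mvfderiv_congr h3, mvfderiv_add h1 h2, h4]
  ext X
  simp only [add_apply, ContinuousLinearMap.comp_apply, map_add]
  abel

theorem pullbackDeriv_smul (hι : IsSubmanifold E E' ι)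
    (D : CovariantDerivative 𝓘(ℝ, E) E (fun x : N => TangentSpace 𝓘(ℝ, E) x))
    {f : M → ℝ} {Y : ∀ x : M, TangentSpace 𝓘(ℝ, E') x}
    (hY : MDiffAt (T% Y) x) (hf : MDiffAt f x) :
    (pullbackDeriv D ι (fun y => dif E E' ι y ((f • Y) y)) x :
      TangentSpace 𝓘(ℝ, E') x →L[ℝ] TangentSpace 𝓘(ℝ, E) (ι x)) =
      f x • pullbackDeriv D ι (fun y => dif E E' ι y (Y y)) x +
        (d% f x).smulRight (dif E E' ι x (Y x)) := by
  have h1 := mdifferentiableAt_coord hι hY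
  simp only [pullbackDeriv]
  have hx : ι x ∈ (trivializationAt E (fun y : N => TangentSpace 𝓘(ℝ, E) y) (ι x)).baseSet :=
    FiberBundle.mem_baseSet_trivializationAt' (ι x)
  have h3 : (fun y => (trivializationAt E (fun y : N => TangentSpace 𝓘(ℝ, E) y) (ι x)
        ⟨ι y, dif E E' ι y ((f • Y) y)⟩).2) =ᶠ[𝓝 x]
      f • fun y => (trivializationAt E (fun y : N => TangentSpace 𝓘(ℝ, E) y) (ι x)
        ⟨ι y, dif E E' ι y (Y y)⟩).2 := by
    filter_upwards [eventually_baseSet hι x] with y hy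
    rw [Pi.smul_apply', Pi.smul_apply', map_smul]
    exact ((trivializationAt E (fun y : N => TangentSpace 𝓘(ℝ, E) y) (ι x)).linear ℝ hy).map_smul _ _
  have h4 : D (extend E (dif E E' ι x ((f • Y) x))) (ι x) =
      f x • D (extend E (dif E E' ι x (Y x))) (ι x) := by
    rw [Pi.smul_apply', map_smul, conn_extend_smul]
  have h5 : (trivializationAt E (fun y : N => TangentSpace 𝓘(ℝ, E) y) (ι x)).symmL ℝ (ι x) (trivializationAt E (fun y : N => TangentSpace 𝓘(ℝ, E) y) (ι x)
        ⟨ι x, dif E E' ι x (Y x)⟩).2 = dif E E' ι x (Y x) := by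
    rw [Trivialization.symmL_apply _ hx]
    exact (trivializationAt E (fun y : N => TangentSpace 𝓘(ℝ, E) y) (ι x)).symm_apply_apply_mk hx _
  rw [mvfderiv_congr h3, mvfderiv_smul hf h1, h4]
  ext X
  simp only [add_apply, smul_apply, ContinuousLinearMap.comp_apply, map_add, map_smul,
    ContinuousLinearMap.smulRight_apply, h5, smul_add]
  abel

/-- The connection `D^M` induced by `D^N` on a submanifold: `D^M_X Y` is the tangential part of
`D^N_X Y`. -/
def inducedConn (S : WeylSpace E N) (hι : IsSubmanifold E E' ι) :
    CovariantDerivative 𝓘(ℝ, E') E' (fun x : M => TangentSpace 𝓘(ℝ, E') x) where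
  toFun Y x := tangentialPart S hι x ∘L pullbackDeriv S.conn ι (fun y => dif E E' ι y (Y y)) x
  isCovariantDerivativeOnUniv := by
    refine ⟨fun {Y Z x} hY hZ _ => ?_, fun {Y f x} hY hf _ => ?_⟩
    · rw [pullbackDeriv_add hι S.conn hY hZ, ContinuousLinearMap.comp_add]
    · rw [pullbackDeriv_smul hι S.conn hY hf]
      ext X
      have h : tangentialPart S hι x (dif E E' ι x (Y x)) = Y x :=
        (exists_tangentialPart S hι x).choose_spec.1 (Y x)
      simp only [add_apply, smul_apply, ContinuousLinearMap.comp_apply, map_add, map_smul,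
        ContinuousLinearMap.smulRight_apply, h]

end PullBack

/-- The second fundamental form `D dι` of a submanifold, with respect to the connections `D^N`
and `D^M`: `(D dι)(X, Y) = D^N_X (dι Y) - dι (D^M_X Y)`, where `Y` is extended to a vector
field. -/
def secondFundamentalForm (S : WeylSpace E N) {ι : M → N} (hι : IsSubmanifold E E' ι) (x : M)
    (X Y : TangentSpace 𝓘(ℝ, E') x) : TangentSpace 𝓘(ℝ, E) (ι x) :=
  pullbackDeriv S.conn ι (fun y => dif E E' ι y (extend E' Y y)) x X -
    dif E E' ι x (inducedConn S hι (extend E' Y) x X)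

/-- `(M, J)` is a `(1,1)`-geodesic submanifold: the `(1,1)`-part
`(X, Y) ↦ (b(X, Y) + b(J X, J Y)) / 2` of the second fundamental form `b = D dι` is zero. -/
def IsOneOneGeodesic (S : WeylSpace E N) {ι : M → N} (hι : IsSubmanifold E E' ι)
    (J : ∀ x : M, TangentSpace 𝓘(ℝ, E') x →L[ℝ] TangentSpace 𝓘(ℝ, E') x) : Prop :=
  ∀ (x : M) (X Y : TangentSpace 𝓘(ℝ, E') x),
    (2⁻¹ : ℝ) • (secondFundamentalForm S hι x X Y +
      secondFundamentalForm S hι x (J x X) (J x Y)) = 0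

/-- `p` is a (smooth) section over the submanifold `M` of the bundle `Q_{N,r}` of isotropic spaces
on `N`, of complex dimension `r`. -/
structure IsIsotropicSection (S : WeylSpace E N) (E' : Type*) [NormedAddCommGroup E']
    [NormedSpace ℝ E'] {M : Type*} [TopologicalSpace M] [ChartedSpace E' M] (ι : M → N) (r : ℕ)
    (p : ∀ x : M, Submodule ℂ (ℂ ⊗[ℝ] TangentSpace 𝓘(ℝ, E) (ι x))) : Prop where
  isotropic : ∀ x, IsIsotropic (S.conf (ι x)) (p x)
  finrank : ∀ x, Module.finrank ℂ (p x) = r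
  smooth : ContMDiff 𝓘(ℝ, E') (endModel E) ∞ (fun x => isoPoint S.conf (ι x) (p x))

variable (E') in
/-- For `p x` tangent to `M`, the corresponding subspace of the complexified tangent space
of `M`. -/
def tangentPlane {ι : M → N} (p : ∀ x : M, Submodule ℂ (ℂ ⊗[ℝ] TangentSpace 𝓘(ℝ, E) (ι x)))
    (x : M) : Submodule ℂ (ℂ ⊗[ℝ] TangentSpace 𝓘(ℝ, E') x) :=
  (p x).comap (cx (dif E E' ι x))

variable (E') in
/-- The almost Hermitian structure `J^p` on `(M, c|_M)` whose eigenbundle corresponding to `-i`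
is `p`. -/
def almostHermitian (S : WeylSpace E N) {ι : M → N}
    (p : ∀ x : M, Submodule ℂ (ℂ ⊗[ℝ] TangentSpace 𝓘(ℝ, E) (ι x))) (x : M) :
    TangentSpace 𝓘(ℝ, E') x →L[ℝ] TangentSpace 𝓘(ℝ, E') x :=
  fStructure (inducedConf S.conf ι x) (tangentPlane E' p x)

end Submanifolds

end WeylTwistor

end

/-! An isotropic space `q` is encoded by its skew-adjoint f-structure `F`, so a section of the
bundle of isotropic spaces becomes a field of endomorphisms, and holomorphicity becomes a condition
on its covariant derivative. The connection splits a vector tangent to `End(TB)` into its projection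
to `B` and its vertical part; for the differential of the section in the direction `X` these are `dι
X` and `D_X F` (`mfderiv_endProj_comp`, `vertPart_mfderiv`).

On the fibres, `𝒥` is characterised by `(𝒥Φ) v = i Φ v` for `v ∈ q`, hence `Φ - i 𝒥Φ` kills the
conjugate of `q`. Therefore, among complexified vectors whose vertical part is tangent to the fibre,
those of `𝒢'` are singled out by two conditions: the projection lies in `q`, and the vertical part
kills the conjugate of `q` (`distG'_le_typeSubmodule`, `mem_distG'`). For a section tangent to `M`
the first condition is automatic, and the second one reads `T(X, Y) + T(JX, JY) = 0`, with `T(X, Y)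
= (D_X F)(dι Y)` and `J = J^p`.

Since `F` is `J` on `TM` and zero on the normal bundle, a Gauss formula holds (`endDeriv_dif`):
`T(X, Y) = dι((D^M_X J) Y) + b(X, JY)`, where the first term is tangent and the second normal to
`M`. So the condition splits. The tangential half is the same criterion for `p` as a section of
`Q_M`; the normal half, with `-JY` in place of `Y`, says that the `(1,1)`-part of `b` is zero.

It remains to see that `D_X F` and `D^M_X J` are tangent to the fibres. They are skew-adjoint
because `D` is conformal, and they satisfy the linearization of `F³ + F = 0`; by
`mem_fibreTangent_of_isSkew` such endomorphisms are commutators of a skew-adjoint endomorphism with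
the f-structure. -/

noncomputable section

set_option linter.unusedSectionVars false

namespace WeylTwistor

/-! ### Product rule on manifolds -/

section Calculus

variable {E' : Type*} [NormedAddCommGroup E'] [NormedSpace ℝ E']
  {M : Type*} [TopologicalSpace M] [ChartedSpace E' M]
  {F₁ F₂ F₃ : Type*} [NormedAddCommGroup F₁] [NormedSpace ℝ F₁] [NormedAddCommGroup F₂]
  [NormedSpace ℝ F₂] [NormedAddCommGroup F₃] [NormedSpace ℝ F₃] {x : M}

/-- The product rule for continuous bilinear maps. -/
theorem mdifferentiableAt_bilin (β : F₁ →L[ℝ] F₂ →L[ℝ] F₃) {f : M → F₁} {g : M → F₂}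
    (hf : MDifferentiableAt 𝓘(ℝ, E') 𝓘(ℝ, F₁) f x) (hg : MDifferentiableAt 𝓘(ℝ, E') 𝓘(ℝ, F₂) g x) :
    MDifferentiableAt 𝓘(ℝ, E') 𝓘(ℝ, F₃) (fun y => β (f y) (g y)) x := by
  have h := β.isBoundedBilinearMap.differentiableAt (f x, g x)
  exact h.mdifferentiableAt.comp x (hf.prodMk_space hg)

theorem mvfderiv_bilin (β : F₁ →L[ℝ] F₂ →L[ℝ] F₃) {f : M → F₁} {g : M → F₂}
    (hf : MDifferentiableAt 𝓘(ℝ, E') 𝓘(ℝ, F₁) f x) (hg : MDifferentiableAt 𝓘(ℝ, E') 𝓘(ℝ, F₂) g x)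
    (X : TangentSpace 𝓘(ℝ, E') x) :
    mvfderiv 𝓘(ℝ, E') (fun y => β (f y) (g y)) x X =
      β (mvfderiv 𝓘(ℝ, E') f x X) (g x) + β (f x) (mvfderiv 𝓘(ℝ, E') g x X) := by
  have h : HasMFDerivAt 𝓘(ℝ, E') 𝓘(ℝ, F₃) (fun y => β (f y) (g y)) x
      (β.precompR E' (f x) (mvfderiv 𝓘(ℝ, E') g x) +
        β.precompL E' (mvfderiv 𝓘(ℝ, E') f x) (g x) : E' →L[ℝ] F₃) := by
    refine ⟨(mdifferentiableAt_bilin β hf hg).continuousAt, ?_⟩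
    have h1 := ContinuousLinearMap.hasFDerivWithinAt_of_bilinear β
      hf.hasMFDerivAt.2 hg.hasMFDerivAt.2
    simp only [writtenInExtChartAt, mfld_simps] at h1 ⊢
    exact h1
  refine Eq.trans (congrArg (fun L : E' →L[ℝ] F₃ => L X) h.mfderiv) ?_
  exact add_comm _ _

theorem mvfderiv_congr_of_eventuallyEq {f g : M → F₁} (h : f =ᶠ[𝓝 x] g) :
    mvfderiv 𝓘(ℝ, E') f x = mvfderiv 𝓘(ℝ, E') g x := by
  ext X
  exact congrArg (fun L : TangentSpace 𝓘(ℝ, E') x →L[ℝ] F₁ => L X) h.mfderiv_eq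

end Calculus

/-! ### Coordinates on the tangent bundle and on `End(TB)` -/

section Coordinates

variable {E : Type*} [NormedAddCommGroup E] [NormedSpace ℝ E] [FiniteDimensional ℝ E]
  {B : Type*} [TopologicalSpace B] [ChartedSpace E B] [IsManifold 𝓘(ℝ, E) ∞ B]
  {E' : Type*} [NormedAddCommGroup E'] [NormedSpace ℝ E']
  {M : Type*} [TopologicalSpace M] [ChartedSpace E' M]

/-- The coordinates of tangent vectors at `y`, in the preferred trivialization at `x`. -/
def crd (x y : B) : TangentSpace 𝓘(ℝ, E) y →L[ℝ] E :=
  (trivializationAt E (fun y : B => TangentSpace 𝓘(ℝ, E) y) x).continuousLinearMapAt ℝ y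

/-- The tangent vector at `y` with given coordinates in the preferred trivialization at `x`. -/
def icrd (x y : B) : E →L[ℝ] TangentSpace 𝓘(ℝ, E) y :=
  (trivializationAt E (fun y : B => TangentSpace 𝓘(ℝ, E) y) x).symmL ℝ y

/-- The domain of the preferred trivialization of the tangent bundle at `x`. -/
abbrev crdSet (x : B) : Set B :=
  (trivializationAt E (fun y : B => TangentSpace 𝓘(ℝ, E) y) x).baseSet

theorem mem_crdSet (x : B) : x ∈ crdSet (E := E) x :=
  FiberBundle.mem_baseSet_trivializationAt' x

theorem crdSet_mem_nhds (x : B) : crdSet (E := E) x ∈ 𝓝 x :=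
  (trivializationAt E (fun y : B => TangentSpace 𝓘(ℝ, E) y) x).open_baseSet.mem_nhds
    (mem_crdSet x)

theorem icrd_crd {x y : B} (hy : y ∈ crdSet (E := E) x) (v : TangentSpace 𝓘(ℝ, E) y) :
    icrd x y (crd x y v) = v :=
  Trivialization.symmL_continuousLinearMapAt _ hy v

theorem crd_icrd {x y : B} (hy : y ∈ crdSet (E := E) x) (u : E) :
    crd x y (icrd x y u) = u :=
  Trivialization.continuousLinearMapAt_symmL _ hy u

@[simp] theorem icrd_crd_self (x : B) (v : TangentSpace 𝓘(ℝ, E) x) :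
    icrd x x (crd x x v) = v := icrd_crd (mem_crdSet x) v

@[simp] theorem crd_icrd_self (x : B) (u : E) : crd x x (icrd x x u) = u :=
  crd_icrd (mem_crdSet x) u

theorem trivializationAt_snd_eq_crd {x y : B} (hy : y ∈ crdSet (E := E) x)
    (v : TangentSpace 𝓘(ℝ, E) y) :
    (trivializationAt E (fun y : B => TangentSpace 𝓘(ℝ, E) y) x ⟨y, v⟩).2 = crd x y v := by
  rw [crd, Trivialization.continuousLinearMapAt_apply, Trivialization.linearMapAt_apply,
    if_pos hy]

theorem extend_eq_icrd {x y : B} (hy : y ∈ crdSet (E := E) x) (v : TangentSpace 𝓘(ℝ, E) x) :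
    extend E v y = icrd x y (crd x x v) := extend_eq v hy

/-- The coordinates of an endomorphism of `T_y B` in the preferred trivialization at `x`. -/
def endCoord (x : B) (w : EndTotal E B) : E →L[ℝ] E :=
  crd x w.1 ∘L w.2 ∘L icrd x w.1

/-- A vector field along a map `ι` is differentiable if so are `ι` and its coordinates. -/
theorem mdifferentiableAt_along_iff {ι : M → B} {V : ∀ y : M, TangentSpace 𝓘(ℝ, E) (ι y)} {x : M} :
    MDifferentiableAt 𝓘(ℝ, E') (𝓘(ℝ, E).prod 𝓘(ℝ, E))
      (fun y => (⟨ι y, V y⟩ : TangentBundle 𝓘(ℝ, E) B)) x ↔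
    MDifferentiableAt 𝓘(ℝ, E') 𝓘(ℝ, E) ι x ∧
      MDifferentiableAt 𝓘(ℝ, E') 𝓘(ℝ, E) (fun y => crd (ι x) (ι y) (V y)) x := by
  rw [mdifferentiableAt_totalSpace]
  refine and_congr_right fun h => Filter.EventuallyEq.mdifferentiableAt_iff ?_
  filter_upwards [h.continuousAt (crdSet_mem_nhds (E := E) (ι x))] with y hy
  exact trivializationAt_snd_eq_crd hy _

theorem mdifferentiableAt_endTotal_iff {f : M → EndTotal E B} {x : M} :
    MDifferentiableAt 𝓘(ℝ, E') (endModel E) f x ↔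
    MDifferentiableAt 𝓘(ℝ, E') 𝓘(ℝ, E) (fun y => (f y).1) x ∧
      MDifferentiableAt 𝓘(ℝ, E') 𝓘(ℝ, E →L[ℝ] E) (fun y => endCoord (f x).1 (f y)) x :=
  mdifferentiableAt_hom_bundle f

theorem mdifferentiableAt_endProj (z : EndTotal E B) :
    MDifferentiableAt (endModel E) 𝓘(ℝ, E) (fun w : EndTotal E B => w.1) z :=
  mdifferentiableAt_proj _

theorem mdifferentiableAt_endCoord (z : EndTotal E B) :
    MDifferentiableAt (endModel E) 𝓘(ℝ, E →L[ℝ] E) (endCoord z.1) z :=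
  ((mdifferentiableAt_hom_bundle (fun w : EndTotal E B => w)).1 mdifferentiableAt_id).2

/-- A tangent vector of `End(TB)` is determined by its projection on `B` and the derivatives,
along it, of the coordinates of endomorphisms. -/
theorem eq_zero_of_endProj_endCoord {z : EndTotal E B} {ξ : TangentSpace (endModel E) z}
    (h1 : mfderiv (endModel E) 𝓘(ℝ, E) (fun w : EndTotal E B => w.1) z ξ = 0)
    (h2 : mvfderiv (endModel E) (endCoord z.1) z ξ = 0) : ξ = 0 := by
  have hinj := (mdifferentiable_chart (I := endModel E) z).mfderiv_injective
    (mem_chart_source (ModelProd E (E →L[ℝ] E)) z)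
  -- The chart of `End(TB)` at `z` is the chart of the base paired with the coordinates of
  -- endomorphisms, and its differential is injective.
  have hc : (chartAt (ModelProd E (E →L[ℝ] E)) z : EndTotal E B → E × (E →L[ℝ] E)) =
      fun w => (chartAt E z.1 w.1, endCoord z.1 w) := funext fun w => hom_chart z w
  have hd : MDifferentiableAt 𝓘(ℝ, E) 𝓘(ℝ, E) (chartAt E z.1) z.1 :=
    (mdifferentiable_chart (I := 𝓘(ℝ, E)) z.1).mdifferentiableAt (mem_chart_source E z.1)
  have hd' : mfderiv (endModel E) 𝓘(ℝ, E) (fun w : EndTotal E B => chartAt E z.1 w.1) z ξ = 0 := by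
    have h := mfderiv_comp_apply z hd (mdifferentiableAt_endProj z) ξ
    refine h.trans ?_
    rw [h1]
    exact ContinuousLinearMap.map_zero _
  have h3 := mfderiv_prodMk (hd.comp z (mdifferentiableAt_endProj z))
    (mdifferentiableAt_endCoord z)
  apply hinj
  refine Eq.trans ?_ (ContinuousLinearMap.map_zero _).symm
  refine (congrArg (fun F => mfderiv (endModel E) (endModel E) F z ξ) hc).trans ?_
  have h4 : ∀ L : TangentSpace (endModel E) z →L[ℝ] E × (E →L[ℝ] E),
      mfderiv (endModel E) (endModel E)
        (fun w : EndTotal E B => (chartAt E z.1 w.1, endCoord z.1 w)) z = L → (L ξ).1 = 0 →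
        (L ξ).2 = 0 → mfderiv (endModel E) (endModel E)
        (fun w : EndTotal E B => (chartAt E z.1 w.1, endCoord z.1 w)) z ξ = 0 := by
    rintro L hL h1 h2
    rw [hL]
    exact Prod.ext h1 h2
  have h5 := h4 _ h3 hd' h2
  -- The product of the model charted spaces agrees with the product model regarded as charted on
  -- itself, which is the structure in the goal.
  rw [chartedSpaceSelf_prod] at h5
  exact h5

end Coordinates

/-! ### Covariant derivatives along maps and vertical parts -/

section Connections

variable {E : Type*} [NormedAddCommGroup E] [NormedSpace ℝ E] [FiniteDimensional ℝ E]
  {B : Type*} [TopologicalSpace B] [ChartedSpace E B] [IsManifold 𝓘(ℝ, E) ∞ B]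
  {E' : Type*} [NormedAddCommGroup E'] [NormedSpace ℝ E']
  {M : Type*} [TopologicalSpace M] [ChartedSpace E' M]
  (D : CovariantDerivative 𝓘(ℝ, E) E (fun x : B => TangentSpace 𝓘(ℝ, E) x))

/-- The Christoffel endomorphism `Γ_X v = D_X v`, where `v` is extended with constant
coordinates. -/
def christoffel (x : B) :
    TangentSpace 𝓘(ℝ, E) x →ₗ[ℝ] TangentSpace 𝓘(ℝ, E) x →L[ℝ] TangentSpace 𝓘(ℝ, E) x where
  toFun X := LinearMap.toContinuousLinearMap
    { toFun := fun v => D (extend E v) x X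
      map_add' := fun v w => by rw [conn_extend_add]; rfl
      map_smul' := fun a v => by rw [conn_extend_smul]; rfl }
  map_add' X Y := by
    ext v
    exact map_add (D (extend E v) x) X Y
  map_smul' a X := by
    ext v
    exact map_smul (D (extend E v) x) a X

theorem christoffel_apply (x : B) (X v : TangentSpace 𝓘(ℝ, E) x) :
    christoffel D x X v = D (extend E v) x X := rfl

/-- Continuity of `ι` keeps nearby points in the domain of the trivialization, where its second
component is linear. This form, derivative of coordinates plus Christoffel term, carries all later
computations. -/
theorem pullbackDeriv_eq {ι : M → B} {x : M} (hι : ContinuousAt ι x)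
    (V : ∀ y : M, TangentSpace 𝓘(ℝ, E) (ι y)) (X : TangentSpace 𝓘(ℝ, E') x) :
    pullbackDeriv D ι V x X =
      icrd (ι x) (ι x) (mvfderiv 𝓘(ℝ, E') (fun y => crd (ι x) (ι y) (V y)) x X) +
        christoffel D (ι x) (dif E E' ι x X) (V x) := by
  have h : (fun y => (trivializationAt E (fun y : B => TangentSpace 𝓘(ℝ, E) y) (ι x)
      ⟨ι y, V y⟩).2) =ᶠ[𝓝 x] fun y => crd (ι x) (ι y) (V y) := by
    filter_upwards [hι (crdSet_mem_nhds (E := E) (ι x))] with y hy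
    exact trivializationAt_snd_eq_crd hy _
  simp only [pullbackDeriv, mvfderiv_congr_of_eventuallyEq h]
  rfl

theorem mdifferentiableAt_field_iff {Y : ∀ y : B, TangentSpace 𝓘(ℝ, E) y} {x : B} :
    MDiffAt (T% Y) x ↔ MDifferentiableAt 𝓘(ℝ, E) 𝓘(ℝ, E) (fun y => crd x y (Y y)) x := by
  have h := mdifferentiableAt_along_iff (E := E) (E' := E) (ι := fun y : B => y) (V := Y) (x := x)
  exact h.trans (and_iff_right mdifferentiableAt_id)

theorem mvfderiv_crd_extend (x : B) (v : TangentSpace 𝓘(ℝ, E) x) :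
    mvfderiv 𝓘(ℝ, E) (fun y => crd x y (extend E v y)) x = 0 := by
  have h : (fun y => crd x y (extend E v y)) =ᶠ[𝓝 x] fun _ => crd x x v := by
    filter_upwards [crdSet_mem_nhds (E := E) x] with y hy
    rw [extend_eq_icrd hy, crd_icrd hy]
  rw [mvfderiv_congr_of_eventuallyEq h, mvfderiv_const]

/-- A connection in coordinates. -/
theorem conn_eq {Y : ∀ y : B, TangentSpace 𝓘(ℝ, E) y} {x : B} (hY : MDiffAt (T% Y) x)
    (X : TangentSpace 𝓘(ℝ, E) x) :
    D Y x X = icrd x x (mvfderiv 𝓘(ℝ, E) (fun y => crd x y (Y y)) x X) +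
      christoffel D x X (Y x) := by
  -- The two terms have the same Leibniz defect, so their difference depends only on `Y x` and can
  -- be computed on the extension with constant coordinates, where the coordinate derivative is
  -- zero.
  have hT : TensorialAt 𝓘(ℝ, E) E (fun Y : ∀ y : B, TangentSpace 𝓘(ℝ, E) y =>
      D Y x X - icrd x x (mvfderiv 𝓘(ℝ, E) (fun y => crd x y (Y y)) x X)) x := by
    constructor
    · intro f σ hf hσ
      have hσ' := mdifferentiableAt_field_iff.1 hσ
      have h1 : (fun y => crd x y ((f • σ) y)) = f • fun y => crd x y (σ y) := by
        ext y; simp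
      rw [h1, mvfderiv_smul hf hσ', D.isCovariantDerivativeOnUniv.leibniz hσ hf]
      simp [smul_sub]
    · intro σ τ hσ hτ
      have hσ' := mdifferentiableAt_field_iff.1 hσ
      have hτ' := mdifferentiableAt_field_iff.1 hτ
      have h1 : (fun y => crd x y ((σ + τ) y)) =
          (fun y => crd x y (σ y)) + fun y => crd x y (τ y) := by
        ext y; simp
      rw [h1, mvfderiv_add hσ' hτ', D.isCovariantDerivativeOnUniv.add hσ hτ]
      simp
      abel
  have h := hT.pointwise hY (mdifferentiableAt_extend 𝓘(ℝ, E) E (Y x)) (by simp)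
  simp only [mvfderiv_crd_extend] at h
  rw [sub_eq_iff_eq_add] at h
  rw [h, christoffel_apply]
  simp
  abel

/-- The covariant derivative of a field of endomorphisms along a map. -/
def endDeriv (ι : M → B) (F : ∀ y : M, TangentSpace 𝓘(ℝ, E) (ι y) →L[ℝ] TangentSpace 𝓘(ℝ, E) (ι y))
    (x : M) (X : TangentSpace 𝓘(ℝ, E') x) :
    TangentSpace 𝓘(ℝ, E) (ι x) →L[ℝ] TangentSpace 𝓘(ℝ, E) (ι x) :=
  icrd (ι x) (ι x) ∘L
      (mvfderiv 𝓘(ℝ, E') (fun y => endCoord (ι x) (⟨ι y, F y⟩ : EndTotal E B)) x X) ∘L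
        crd (ι x) (ι x) +
    (christoffel D (ι x) (dif E E' ι x X) ∘L F x - F x ∘L christoffel D (ι x) (dif E E' ι x X))

/-- The vertical part, with respect to the connection induced by `D` on `End(TB)`, of a vector
tangent to `End(TB)`. -/
def vertPart (z : EndTotal E B) :
    TangentSpace (endModel E) z →ₗ[ℝ] TangentSpace 𝓘(ℝ, E) z.1 →L[ℝ] TangentSpace 𝓘(ℝ, E) z.1 where
  toFun ξ := icrd z.1 z.1 ∘L (mvfderiv (endModel E) (endCoord z.1) z ξ) ∘L crd z.1 z.1 +
    (christoffel D z.1 (mfderiv (endModel E) 𝓘(ℝ, E) (fun w : EndTotal E B => w.1) z ξ) ∘L z.2 -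
      z.2 ∘L christoffel D z.1 (mfderiv (endModel E) 𝓘(ℝ, E) (fun w : EndTotal E B => w.1) z ξ))
  map_add' ξ η := by
    rw [(mvfderiv (endModel E) (endCoord z.1) z).map_add,
      (mfderiv (endModel E) 𝓘(ℝ, E) (fun w : EndTotal E B => w.1) z).map_add, map_add]
    ext v
    simp only [ContinuousLinearMap.comp_apply, add_apply, sub_apply, map_add]
    abel
  map_smul' a ξ := by
    rw [(mvfderiv (endModel E) (endCoord z.1) z).map_smul,
      (mfderiv (endModel E) 𝓘(ℝ, E) (fun w : EndTotal E B => w.1) z).map_smul, map_smul]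
    ext v
    simp only [ContinuousLinearMap.comp_apply, add_apply, sub_apply, map_smul, smul_apply,
      RingHom.id_apply, smul_add, smul_sub]

/-- The chain rule, applied to the projection and to `endCoord`. This turns conditions on the
differential of a section into conditions on its covariant derivative. -/
theorem vertPart_mfderiv {ι : M → B}
    {F : ∀ y : M, TangentSpace 𝓘(ℝ, E) (ι y) →L[ℝ] TangentSpace 𝓘(ℝ, E) (ι y)} {x : M}
    (hF : MDifferentiableAt 𝓘(ℝ, E') (endModel E) (fun y => (⟨ι y, F y⟩ : EndTotal E B)) x)
    (X : TangentSpace 𝓘(ℝ, E') x) :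
    vertPart D ⟨ι x, F x⟩
      (mfderiv 𝓘(ℝ, E') (endModel E) (fun y => (⟨ι y, F y⟩ : EndTotal E B)) x X) =
      endDeriv D ι F x X := by
  have h1 : mfderiv (endModel E) 𝓘(ℝ, E) (fun w : EndTotal E B => w.1) ⟨ι x, F x⟩
      (mfderiv 𝓘(ℝ, E') (endModel E) (fun y => (⟨ι y, F y⟩ : EndTotal E B)) x X) =
      dif E E' ι x X :=
    (mfderiv_comp_apply x (mdifferentiableAt_endProj (⟨ι x, F x⟩ : EndTotal E B)) hF X).symm
  have h2 : mvfderiv (endModel E) (endCoord (ι x)) (⟨ι x, F x⟩ : EndTotal E B)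
      (mfderiv 𝓘(ℝ, E') (endModel E) (fun y => (⟨ι y, F y⟩ : EndTotal E B)) x X) =
      mvfderiv 𝓘(ℝ, E') (fun y => endCoord (ι x) (⟨ι y, F y⟩ : EndTotal E B)) x X :=
    (mfderiv_comp_apply x (mdifferentiableAt_endCoord (⟨ι x, F x⟩ : EndTotal E B)) hF X).symm
  simp only [vertPart, LinearMap.coe_mk, AddHom.coe_mk, endDeriv]
  erw [h1, h2]

theorem mfderiv_endProj_comp {ι : M → B}
    {F : ∀ y : M, TangentSpace 𝓘(ℝ, E) (ι y) →L[ℝ] TangentSpace 𝓘(ℝ, E) (ι y)} {x : M}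
    (hF : MDifferentiableAt 𝓘(ℝ, E') (endModel E) (fun y => (⟨ι y, F y⟩ : EndTotal E B)) x)
    (X : TangentSpace 𝓘(ℝ, E') x) :
    mfderiv (endModel E) 𝓘(ℝ, E) (fun w : EndTotal E B => w.1) ⟨ι x, F x⟩
      (mfderiv 𝓘(ℝ, E') (endModel E) (fun y => (⟨ι y, F y⟩ : EndTotal E B)) x X) =
      dif E E' ι x X :=
  (mfderiv_comp_apply x (mdifferentiableAt_endProj (⟨ι x, F x⟩ : EndTotal E B)) hF X).symm

theorem crd_apply_eq_endCoord {ι : M → B}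
    {F : ∀ y : M, TangentSpace 𝓘(ℝ, E) (ι y) →L[ℝ] TangentSpace 𝓘(ℝ, E) (ι y)}
    {V : ∀ y : M, TangentSpace 𝓘(ℝ, E) (ι y)} {x y : M} (hy : ι y ∈ crdSet (E := E) (ι x)) :
    crd (ι x) (ι y) (F y (V y)) =
      endCoord (ι x) (⟨ι y, F y⟩ : EndTotal E B) (crd (ι x) (ι y) (V y)) := by
  simp only [endCoord, ContinuousLinearMap.comp_apply]
  rw [icrd_crd hy]

theorem mdifferentiableAt_along_apply {ι : M → B}
    {F : ∀ y : M, TangentSpace 𝓘(ℝ, E) (ι y) →L[ℝ] TangentSpace 𝓘(ℝ, E) (ι y)} {x : M}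
    (hF : MDifferentiableAt 𝓘(ℝ, E') (endModel E) (fun y => (⟨ι y, F y⟩ : EndTotal E B)) x)
    {V : ∀ y : M, TangentSpace 𝓘(ℝ, E) (ι y)}
    (hV : MDifferentiableAt 𝓘(ℝ, E') (𝓘(ℝ, E).prod 𝓘(ℝ, E))
      (fun y => (⟨ι y, V y⟩ : TangentBundle 𝓘(ℝ, E) B)) x) :
    MDifferentiableAt 𝓘(ℝ, E') (𝓘(ℝ, E).prod 𝓘(ℝ, E))
      (fun y => (⟨ι y, F y (V y)⟩ : TangentBundle 𝓘(ℝ, E) B)) x := by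
  rw [mdifferentiableAt_along_iff] at hV ⊢
  rw [mdifferentiableAt_endTotal_iff] at hF
  refine ⟨hV.1, (hF.2.clm_apply hV.2).congr_of_eventuallyEq ?_⟩
  filter_upwards [hV.1.continuousAt (crdSet_mem_nhds (E := E) (ι x))] with y hy
  exact crd_apply_eq_endCoord hy

/-- The Leibniz rule: `D_X (F V) = (D_X F) V + F (D_X V)`. -/
theorem pullbackDeriv_apply {ι : M → B}
    {F : ∀ y : M, TangentSpace 𝓘(ℝ, E) (ι y) →L[ℝ] TangentSpace 𝓘(ℝ, E) (ι y)} {x : M}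
    (hF : MDifferentiableAt 𝓘(ℝ, E') (endModel E) (fun y => (⟨ι y, F y⟩ : EndTotal E B)) x)
    {V : ∀ y : M, TangentSpace 𝓘(ℝ, E) (ι y)}
    (hV : MDifferentiableAt 𝓘(ℝ, E') (𝓘(ℝ, E).prod 𝓘(ℝ, E))
      (fun y => (⟨ι y, V y⟩ : TangentBundle 𝓘(ℝ, E) B)) x) (X : TangentSpace 𝓘(ℝ, E') x) :
    pullbackDeriv D ι (fun y => F y (V y)) x X =
      endDeriv D ι F x X (V x) + F x (pullbackDeriv D ι V x X) := by
  rw [mdifferentiableAt_along_iff] at hV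
  rw [mdifferentiableAt_endTotal_iff] at hF
  have hc := hV.1.continuousAt
  -- The identity of `E →L[ℝ] E`, read as a bilinear map, is evaluation; in this form the product
  -- rule applies.
  have h : (fun y => crd (ι x) (ι y) (F y (V y))) =ᶠ[𝓝 x] fun y =>
      (ContinuousLinearMap.id ℝ (E →L[ℝ] E))
        (endCoord (ι x) (⟨ι y, F y⟩ : EndTotal E B)) (crd (ι x) (ι y) (V y)) := by
    filter_upwards [hc (crdSet_mem_nhds (E := E) (ι x))] with y hy
    exact crd_apply_eq_endCoord hy
  rw [pullbackDeriv_eq D hc, pullbackDeriv_eq D hc, mvfderiv_congr_of_eventuallyEq h,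
    mvfderiv_bilin _ hF.2 hV.2]
  simp only [endDeriv, endCoord, ContinuousLinearMap.comp_apply, add_apply, sub_apply, map_add,
    ContinuousLinearMap.id_apply, icrd_crd_self]
  abel

end Connections

/-! ### The horizontal space as the kernel of the vertical part -/

section Horizontal

variable {E : Type*} [NormedAddCommGroup E] [NormedSpace ℝ E] [FiniteDimensional ℝ E]
  {B : Type*} [TopologicalSpace B] [ChartedSpace E B] [IsManifold 𝓘(ℝ, E) ∞ B]
  (D : CovariantDerivative 𝓘(ℝ, E) E (fun x : B => TangentSpace 𝓘(ℝ, E) x))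

theorem dif_id (x : B) (X : TangentSpace 𝓘(ℝ, E) x) : dif E E (fun y : B => y) x X = X := by
  have h : dif E E (fun y : B => y) x = ContinuousLinearMap.id ℝ _ := mfderiv_id
  rw [h]
  rfl

theorem pullbackDeriv_id {Y : ∀ y : B, TangentSpace 𝓘(ℝ, E) y} {x : B} (hY : MDiffAt (T% Y) x)
    (X : TangentSpace 𝓘(ℝ, E) x) :
    pullbackDeriv D (fun y : B => y) Y x X = D Y x X := by
  rw [pullbackDeriv_eq D (ι := fun y : B => y) continuousAt_id, conn_eq D hY, dif_id]

/-- Once the projection is zero the Christoffel terms drop out, and the vertical part is just the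
derivative of the coordinates of endomorphisms. -/
theorem eq_zero_of_endProj_vertPart {z : EndTotal E B} {ξ : TangentSpace (endModel E) z}
    (h1 : mfderiv (endModel E) 𝓘(ℝ, E) (fun w : EndTotal E B => w.1) z ξ = 0)
    (h2 : vertPart D z ξ = 0) : ξ = 0 := by
  refine eq_zero_of_endProj_endCoord h1 ?_
  simp only [vertPart, LinearMap.coe_mk, AddHom.coe_mk, h1, map_zero] at h2
  ext u
  have h3 := congrArg (fun L : TangentSpace 𝓘(ℝ, E) z.1 →L[ℝ] TangentSpace 𝓘(ℝ, E) z.1 =>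
    crd z.1 z.1 (L (icrd z.1 z.1 u))) h2
  simpa using h3

theorem endLine_zero (z : EndTotal E B)
    (Φ : TangentSpace 𝓘(ℝ, E) z.1 →L[ℝ] TangentSpace 𝓘(ℝ, E) z.1) :
    (⟨z.1, z.2 + (0 : ℝ) • Φ⟩ : EndTotal E B) = z := by
  rw [zero_smul, add_zero]

theorem endCoord_endLine (z : EndTotal E B)
    (Φ : TangentSpace 𝓘(ℝ, E) z.1 →L[ℝ] TangentSpace 𝓘(ℝ, E) z.1) (t : ℝ) :
    endCoord z.1 (⟨z.1, z.2 + t • Φ⟩ : EndTotal E B) =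
      endCoord z.1 z + t • (crd z.1 z.1 ∘L Φ ∘L icrd z.1 z.1) := by
  ext u
  simp [endCoord]

theorem mdifferentiableAt_endLine (z : EndTotal E B)
    (Φ : TangentSpace 𝓘(ℝ, E) z.1 →L[ℝ] TangentSpace 𝓘(ℝ, E) z.1) :
    MDifferentiableAt 𝓘(ℝ, ℝ) (endModel E)
      (fun t : ℝ => (⟨z.1, z.2 + t • Φ⟩ : EndTotal E B)) 0 := by
  rw [mdifferentiableAt_endTotal_iff]
  refine ⟨mdifferentiableAt_const, ?_⟩
  simp only [endCoord_endLine]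
  exact (((differentiableAt_id (𝕜 := ℝ)).smul_const _).const_add _).mdifferentiableAt

theorem mfderiv_endProj_vertLift (z : EndTotal E B)
    (Φ : TangentSpace 𝓘(ℝ, E) z.1 →L[ℝ] TangentSpace 𝓘(ℝ, E) z.1) :
    mfderiv (endModel E) 𝓘(ℝ, E) (fun w : EndTotal E B => w.1) z (vertLift z Φ) = 0 := by
  have h := mfderiv_comp_apply_of_eq (0 : ℝ) (mdifferentiableAt_endProj z)
    (mdifferentiableAt_endLine z Φ) (endLine_zero z Φ) (1 : ℝ)
  refine h.symm.trans ?_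
  have h1 : mfderiv 𝓘(ℝ, ℝ) 𝓘(ℝ, E) (fun _ : ℝ => z.1) 0 = 0 := mfderiv_const
  exact congrArg (fun L : ℝ →L[ℝ] E => L 1) h1

theorem mvfderiv_endCoord_vertLift (z : EndTotal E B)
    (Φ : TangentSpace 𝓘(ℝ, E) z.1 →L[ℝ] TangentSpace 𝓘(ℝ, E) z.1) :
    mvfderiv (endModel E) (endCoord z.1) z (vertLift z Φ) =
      crd z.1 z.1 ∘L Φ ∘L icrd z.1 z.1 := by
  have h := mfderiv_comp_apply_of_eq (0 : ℝ) (mdifferentiableAt_endCoord z)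
    (mdifferentiableAt_endLine z Φ) (endLine_zero z Φ) (1 : ℝ)
  refine h.symm.trans ?_
  have h1 : HasFDerivAt (fun t : ℝ => endCoord z.1 z + t • (crd z.1 z.1 ∘L Φ ∘L icrd z.1 z.1))
      ((1 : ℝ →L[ℝ] ℝ).smulRight (crd z.1 z.1 ∘L Φ ∘L icrd z.1 z.1)) 0 :=
    (((1 : ℝ →L[ℝ] ℝ).hasFDerivAt).smul_const _).const_add _
  have h2 : (endCoord z.1 ∘ fun t : ℝ => (⟨z.1, z.2 + t • Φ⟩ : EndTotal E B)) =
      fun t : ℝ => endCoord z.1 z + t • (crd z.1 z.1 ∘L Φ ∘L icrd z.1 z.1) :=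
    funext fun t => endCoord_endLine z Φ t
  rw [h2, mfderiv_eq_fderiv, h1.fderiv]
  exact one_smul ℝ _

theorem vertPart_vertLift (z : EndTotal E B)
    (Φ : TangentSpace 𝓘(ℝ, E) z.1 →L[ℝ] TangentSpace 𝓘(ℝ, E) z.1) :
    vertPart D z (vertLift z Φ) = Φ := by
  simp only [vertPart, LinearMap.coe_mk, AddHom.coe_mk, mfderiv_endProj_vertLift, map_zero,
    mvfderiv_endCoord_vertLift]
  ext v
  simp

/-- Each vector at `x` is lifted by a parallel field of endomorphisms. -/
theorem exists_endDeriv_eq_zero (x : B)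
    (F : TangentSpace 𝓘(ℝ, E) x →L[ℝ] TangentSpace 𝓘(ℝ, E) x) :
    ∃ σ : ∀ y : B, TangentSpace 𝓘(ℝ, E) y →L[ℝ] TangentSpace 𝓘(ℝ, E) y, σ x = F ∧
      MDifferentiableAt 𝓘(ℝ, E) (endModel E) (fun y => (⟨y, σ y⟩ : EndTotal E B)) x ∧
      ∀ X : TangentSpace 𝓘(ℝ, E) x, endDeriv (E' := E) (M := B) D (fun y : B => y) σ x X = 0 := by
  -- The field is taken affine in the chart. Its coordinate derivative `L` along `X` is the
  -- commutator `[F, Γ_X]`, chosen to cancel the term `[Γ_X, F]` of the covariant derivative at `x`.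
  let L : E →L[ℝ] E →L[ℝ] E := LinearMap.toContinuousLinearMap
    { toFun := fun u => crd x x ∘L (F ∘L christoffel D x (icrd x x u) -
        christoffel D x (icrd x x u) ∘L F) ∘L icrd x x
      map_add' := fun u v => by ext w; simp; abel
      map_smul' := fun a v => by ext w; simp [smul_sub] }
  let G : B → E →L[ℝ] E := fun y =>
    crd x x ∘L F ∘L icrd x x + L (extChartAt 𝓘(ℝ, E) x y - extChartAt 𝓘(ℝ, E) x x)
  let σ : ∀ y : B, TangentSpace 𝓘(ℝ, E) y →L[ℝ] TangentSpace 𝓘(ℝ, E) y :=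
    fun y => icrd x y ∘L G y ∘L crd x y
  have hσx : σ x = F := by
    ext v
    simp [σ, G]
  have hc : (fun y => endCoord x (⟨y, σ y⟩ : EndTotal E B)) =ᶠ[𝓝 x] G := by
    filter_upwards [crdSet_mem_nhds (E := E) x] with y hy
    ext u
    simp only [endCoord, σ, ContinuousLinearMap.comp_apply, crd_icrd hy]
  have hd : MDifferentiableAt 𝓘(ℝ, E) 𝓘(ℝ, E) (extChartAt 𝓘(ℝ, E) x) x :=
    mdifferentiableAt_extChartAt (mem_chart_source E x)
  have hG1 : MDifferentiableAt 𝓘(ℝ, E) 𝓘(ℝ, E →L[ℝ] E)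
      (fun y => L (extChartAt 𝓘(ℝ, E) x y)) x := L.mdifferentiableAt.comp x hd
  have hGe : G = (fun _ => crd x x ∘L F ∘L icrd x x - L (extChartAt 𝓘(ℝ, E) x x)) +
      fun y => L (extChartAt 𝓘(ℝ, E) x y) := by
    ext y u
    simp [G]
    abel
  have hG : MDifferentiableAt 𝓘(ℝ, E) 𝓘(ℝ, E →L[ℝ] E) G x := by
    rw [hGe]
    exact mdifferentiableAt_const.add hG1
  have hG' : ∀ X, mvfderiv 𝓘(ℝ, E) G x X = L (crd x x X) := by
    intro X
    rw [hGe, mvfderiv_add mdifferentiableAt_const hG1, mvfderiv_const, add_apply]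
    refine (zero_add _).trans ?_
    refine (mfderiv_comp_apply x (L.mdifferentiableAt (x := extChartAt 𝓘(ℝ, E) x x)) hd X).trans ?_
    -- At its base point, the differential of the chart is the preferred trivialization of the
    -- tangent bundle.
    rw [L.mfderiv_eq, ← TangentBundle.continuousLinearMapAt_trivializationAt
      (mem_chart_source E x)]
    rfl
  refine ⟨σ, hσx, ?_, fun X => ?_⟩
  · rw [mdifferentiableAt_endTotal_iff]
    exact ⟨mdifferentiableAt_id, hG.congr_of_eventuallyEq hc⟩
  · simp only [endDeriv]
    rw [mvfderiv_congr_of_eventuallyEq hc, hG', dif_id, hσx]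
    ext v
    simp [L]

/-- The horizontal space is the kernel of the vertical part. -/
theorem mem_horizontal_iff {z : EndTotal E B} {ξ : TangentSpace (endModel E) z} :
    ξ ∈ horizontal D z ↔ vertPart D z ξ = 0 := by
  obtain ⟨x, F⟩ := z
  constructor
  · intro h
    change ξ ∈ LinearMap.ker (vertPart D _)
    refine Submodule.span_le.2 ?_ h
    rintro _ ⟨σ, X, (h1 : σ x = F), h2, h3, rfl⟩
    subst h1
    refine (vertPart_mfderiv D h2 X).trans ?_
    ext v
    -- Testing on an extension of `v`: parallelism of `σ` and the Leibniz rule leave only `(D_X σ)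
    -- v`, which must vanish.
    have hv := mdifferentiableAt_extend 𝓘(ℝ, E) E v
    have h4 := pullbackDeriv_apply D h2 hv X
    have h5 := h3 _ hv
    rw [pullbackDeriv_id D (mdifferentiableAt_along_apply h2 hv), pullbackDeriv_id D hv, h5,
      extend_apply_self] at h4
    simpa using h4
  · intro h
    -- With `σ` parallel at `x` and `X` the projection of `ξ`, the vectors `ξ` and `dσ(X)` have the
    -- same projection and both have zero vertical part, so they coincide.
    obtain ⟨σ, h1, h2, h3⟩ := exists_endDeriv_eq_zero D x F
    subst h1
    let X : TangentSpace 𝓘(ℝ, E) x :=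
      mfderiv (endModel E) 𝓘(ℝ, E) (fun w : EndTotal E B => w.1) ⟨x, σ x⟩ ξ
    have h4 : ξ = mfderiv 𝓘(ℝ, E) (endModel E) (fun y => (⟨y, σ y⟩ : EndTotal E B)) x X := by
      rw [← sub_eq_zero]
      refine eq_zero_of_endProj_vertPart D ?_ ?_
      · rw [(mfderiv (endModel E) 𝓘(ℝ, E) (fun w : EndTotal E B => w.1) ⟨x, σ x⟩).map_sub,
          mfderiv_endProj_comp h2, dif_id]
        exact sub_self _
      · rw [map_sub, h, vertPart_mfderiv D h2, h3, sub_zero]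
    refine Submodule.subset_span ⟨σ, X, rfl, h2, fun Y hY => ?_, h4⟩
    have h5 := pullbackDeriv_apply D h2 hY X
    rw [pullbackDeriv_id D (mdifferentiableAt_along_apply h2 hY), pullbackDeriv_id D hY, h3] at h5
    simpa using h5

end Horizontal

/-! ### Linear algebra of the fibres and of their complex structure -/

section LinearAlgebra

variable {V : Type*} [AddCommGroup V] [Module ℝ V] [TopologicalSpace V]

theorem reV_smul (a : ℂ) (z : ℂ ⊗[ℝ] V) : reV (a • z) = a.re • reV z - a.im • imV z := by
  induction z with
  | zero => simp
  | tmul b v => simp [TensorProduct.smul_tmul', sub_smul, mul_smul]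
  | add x y hx hy => simp only [smul_add, map_add, hx, hy]; abel

theorem imV_smul (a : ℂ) (z : ℂ ⊗[ℝ] V) : imV (a • z) = a.re • imV z + a.im • reV z := by
  induction z with
  | zero => simp
  | tmul b v => simp [TensorProduct.smul_tmul', add_smul, mul_smul]
  | add x y hx hy => simp only [smul_add, map_add, hx, hy]; abel

theorem mem_baseChange_complex_iff {H : Submodule ℝ V} {z : ℂ ⊗[ℝ] V} :
    z ∈ H.baseChange ℂ ↔ reV z ∈ H ∧ imV z ∈ H := by
  constructor
  · intro h
    rw [Submodule.baseChange_eq_span] at h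
    refine Submodule.span_induction ?_ ?_ ?_ ?_ h
    · rintro _ ⟨v, hv, rfl⟩
      simpa using hv
    · simp
    · intro x y _ _ hx hy
      simp only [map_add]
      exact ⟨H.add_mem hx.1 hy.1, H.add_mem hx.2 hy.2⟩
    · intro a x _ hx
      rw [reV_smul, imV_smul]
      exact ⟨H.sub_mem (H.smul_mem _ hx.1) (H.smul_mem _ hx.2),
        H.add_mem (H.smul_mem _ hx.2) (H.smul_mem _ hx.1)⟩
  · rintro ⟨h1, h2⟩
    rw [← reV_add_imV z]
    exact add_mem (Submodule.tmul_mem_baseChange_of_mem _ h1)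
      (Submodule.tmul_mem_baseChange_of_mem _ h2)

theorem fibreTangent_neg {c : Set (V →L[ℝ] V →L[ℝ] ℝ)} {F Φ : V →L[ℝ] V} [IsTopologicalAddGroup V]
    (h : Φ ∈ fibreTangent c F) : -Φ ∈ fibreTangent c F := by
  obtain ⟨A, h1, h2⟩ := h
  refine ⟨-A, fun b hb v w => ?_, fun v => ?_⟩
  · have := h1 b hb v w
    simp only [neg_apply, map_neg]
    linarith
  · simp only [neg_apply, map_neg, h2 v]
    abel

/-- If `w` represents `δ v` then `i w` represents `i δ v`, and comparing `(F + i) w = -Φ v` with `(F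
+ i)(i w) = -Ψ v` gives `Ψ v = i Φ v`. The equality is the imaginary part of this; applied also to
`i v`, it says that `Φ - i Ψ` kills the conjugate of `q`. -/
theorem IsTimesI.apply_re {F Φ Ψ : V →L[ℝ] V} (h : IsTimesI F Φ Ψ) {v : ℂ ⊗[ℝ] V}
    (hv : v ∈ minusI F) : Φ (reV v) = Ψ (imV v) := by
  obtain ⟨δ, h1, h2⟩ := h
  obtain ⟨w, hw⟩ := (minusI F).mkQ_surjective (δ ⟨v, hv⟩)
  have h3 := h1 ⟨v, hv⟩ w hw
  have h4 := h2 ⟨v, hv⟩ (Complex.I • w) (by rw [map_smul, hw, LinearMap.smul_apply])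
  rw [map_smul, ← smul_add, h3] at h4
  have h5 := congrArg imV h4
  simp only [map_neg, smul_neg, imV_I_smul, reV_cx, imV_cx] at h5
  exact neg_injective h5

/-- The criterion for `Ψ = 𝒥 Φ`. -/
theorem isTimesI_of_apply {c : Set (V →L[ℝ] V →L[ℝ] ℝ)} {F Φ Ψ : V →L[ℝ] V}
    (hΦ : Φ ∈ fibreTangent c F) (h : ∀ v ∈ minusI F, Φ (reV v) = Ψ (imV v)) :
    IsTimesI F Φ Ψ := by
  obtain ⟨A, -, hA⟩ := hΦ
  -- For `Φ = [A, F]` the velocity of the plane is the class of `A v`: as `F v = -i v`, one has `(F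
  -- + i)(A v) = F A v - A F v = -Φ v`, and `F + i` ignores changes of `w` by elements of `q`.
  have key : ∀ v ∈ minusI F, ∀ w, w - cx A v ∈ minusI F →
      cx F w + Complex.I • w = - cx Φ v := by
    intro v hv w hw
    rw [mem_minusI] at hv hw
    simp only [map_sub, reV_cx, imV_cx] at hw
    obtain ⟨h1, h2⟩ := hw
    apply ext_reV_imV
    · simp only [map_add, map_neg, reV_cx, reV_I_smul, hA, hv.1]
      rw [sub_eq_iff_eq_add] at h1
      rw [h1]; abel
    · simp only [map_add, map_neg, imV_cx, imV_I_smul, hA, hv.2]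
      rw [sub_eq_iff_eq_add] at h2
      rw [h2]; abel
  refine ⟨(minusI F).mkQ ∘ₗ cx A ∘ₗ (minusI F).subtype, fun v w hw => ?_, fun v w hw => ?_⟩
  · refine key v v.2 w ?_
    rwa [← Submodule.Quotient.eq]
  -- The velocity multiplied by `i` is the class of `A (i v)`, so the first case at `i v` gives `-Φ
  -- (i v)`, which is `-Ψ v` by the hypothesis at `v` and at `i v`.
  · have hv := (mem_minusI.1 v.2)
    have hIv : Complex.I • (v : ℂ ⊗[ℝ] V) ∈ minusI F := (minusI F).smul_mem _ v.2
    rw [key (Complex.I • v) hIv w]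
    · have e1 := h v v.2
      have e2 := h _ hIv
      simp only [reV_I_smul, imV_I_smul, map_neg] at e2
      apply ext_reV_imV
      · simp only [map_neg, map_smul, reV_I_smul, reV_cx, imV_cx, e2]
      · simp only [map_neg, map_smul, imV_I_smul, imV_cx, reV_cx, e1]
    · rw [map_smul, ← Submodule.Quotient.eq]
      exact hw

/-- A skew-adjoint endomorphism which satisfies the linearization of `F³ + F = 0` is tangent to
the space of skew-adjoint `f`-structures. -/
theorem mem_fibreTangent_of_isSkew [IsTopologicalAddGroup V] [ContinuousSMul ℝ V]
    {c : Set (V →L[ℝ] V →L[ℝ] ℝ)} {F Φ : V →L[ℝ] V} (hF : IsSkew c F) (hΦ : IsSkew c Φ)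
    (hF3 : ∀ v, F (F (F v)) + F v = 0)
    (h : ∀ v, F (F (Φ v)) + F (Φ (F v)) + Φ (F (F v)) + Φ v = 0) : Φ ∈ fibreTangent c F := by
  have hF3' : ∀ v, F (F (F v)) = - F v := fun v => eq_neg_of_add_eq_zero_left (hF3 v)
  have h1 : ∀ v, F (F (Φ (F (F v)))) = F (Φ (F v)) := by
    intro v
    have h2 := congrArg F (h (F v))
    simp only [map_add, hF3', map_neg, map_zero] at h2
    rw [← sub_eq_zero, ← h2]
    abel
  have h2 : ∀ v, F (F (Φ (F v))) = - F (Φ (F (F v))) := by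
    intro v
    have h3 := congrArg F (h1 v)
    rw [hF3'] at h3
    exact h3.symm
  -- On the block of `Φ` from the `b`- to the `a`-eigenspace of `F`, with `a, b ∈ {0, i, -i}`, the
  -- map `A ↦ [A, F]` is multiplication by `b - a`, and the linearized cubic kills the blocks with
  -- `a = b`. So `A` must be the block divided by `b - a`: the factor `a - b` achieves this if `a`
  -- or `b` is zero, and the term `-(3/2) a² b` corrects the blocks between `i` and `-i`.
  refine ⟨F ∘L Φ - Φ ∘L F - (3 / 2 : ℝ) • (F ∘L F ∘L Φ ∘L F), fun b hb v w => ?_, fun v => ?_⟩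
  · have e1 := hF b hb
    have e2 := hΦ b hb
    have a1 : b (F (Φ v)) w = b v (Φ (F w)) := by
      linarith [e1 (Φ v) w, e2 v (F w)]
    have a2 : b (Φ (F v)) w = b v (F (Φ w)) := by
      linarith [e2 (F v) w, e1 v (Φ w)]
    have a3 : b (F (F (Φ (F v)))) w = b v (F (Φ (F (F w)))) := by
      linarith [e1 (F (Φ (F v))) w, e1 (Φ (F v)) (F w), e2 (F v) (F (F w)),
        e1 v (Φ (F (F w)))]
    have a4 : b v (F (F (Φ (F w)))) = - b v (F (Φ (F (F w)))) := by rw [h2, map_neg]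
    simp only [sub_apply, smul_apply, ContinuousLinearMap.comp_apply, map_sub, map_smul,
      smul_eq_mul]
    rw [a1, a2, a3, a4]
    ring
  · have e := h v
    simp only [sub_apply, smul_apply, ContinuousLinearMap.comp_apply, map_sub, map_smul, h1, hF3']
    have e' : Φ v = - F (F (Φ v)) - F (Φ (F v)) - Φ (F (F v)) := by
      rw [← sub_eq_zero, ← h v]; abel
    refine e'.trans ?_
    module

end LinearAlgebra

/-! ### The distribution `𝒢'` and the criterion of holomorphicity -/

section Holomorphic

variable {E : Type*} [NormedAddCommGroup E] [NormedSpace ℝ E] [FiniteDimensional ℝ E]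
  {B : Type*} [TopologicalSpace B] [ChartedSpace E B] [IsManifold 𝓘(ℝ, E) ∞ B]
  {c : ∀ x : B, Set (TangentSpace 𝓘(ℝ, E) x →L[ℝ] TangentSpace 𝓘(ℝ, E) x →L[ℝ] ℝ)}
  {D : CovariantDerivative 𝓘(ℝ, E) E (fun x : B => TangentSpace 𝓘(ℝ, E) x)}

variable (D) in
/-- The complexified vectors tangent to `End(TB)` whose projection is in `q = ker (F + i)` and
whose vertical part vanishes on the conjugate of `q`. -/
def typeSubmodule (z : EndTotal E B) : Submodule ℂ (ℂ ⊗[ℝ] TangentSpace (endModel E) z) where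
  carrier := {ζ | cx (mfderiv (endModel E) 𝓘(ℝ, E) (fun w : EndTotal E B => w.1) z) ζ ∈ minusI z.2 ∧
    ∀ v ∈ minusI z.2,
      vertPart D z (reV ζ) (reV v) + vertPart D z (imV ζ) (imV v) = 0}
  zero_mem' := by
    refine ⟨by rw [map_zero]; exact zero_mem _, fun v _ => ?_⟩
    simp only [map_zero, zero_apply, add_zero]
  add_mem' := by
    rintro ζ η ⟨h1, h2⟩ ⟨h3, h4⟩
    refine ⟨by rw [map_add]; exact add_mem h1 h3, fun v hv => ?_⟩
    simp only [map_add, add_apply]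
    rw [add_add_add_comm, h2 v hv, h4 v hv, add_zero]
  smul_mem' := by
    rintro a ζ ⟨h1, h2⟩
    refine ⟨by rw [map_smul]; exact Submodule.smul_mem _ _ h1, fun v hv => ?_⟩
    have e1 := h2 v hv
    -- The defining equation is only the real part of the vanishing on the conjugate of `v`; taken
    -- at `i v` it yields the imaginary part, which complex multiples require.
    have e2 := h2 _ ((minusI z.2).smul_mem Complex.I hv)
    simp only [reV_I_smul, imV_I_smul, map_neg] at e2
    rw [reV_smul, imV_smul]
    simp only [map_add, map_sub, map_smul, add_apply, sub_apply, smul_apply]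
    rw [add_eq_zero_iff_eq_neg] at e1
    rw [neg_add_eq_zero] at e2
    rw [e1, e2]
    module

/-- Horizontal vectors have no vertical part, while a generator of `(ker dπ)^{1,0}` has zero
projection and kills the conjugate of `q` by `IsTimesI.apply_re`. -/
theorem distG'_le_typeSubmodule (z : EndTotal E B) : distG' c D z ≤ typeSubmodule D z := by
  refine sup_le ?_ (Submodule.span_le.2 ?_)
  · rintro ζ ⟨h1, h2⟩
    refine ⟨h2, fun v _ => ?_⟩
    have h3 := mem_baseChange_complex_iff.1 h1
    rw [(mem_horizontal_iff D).1 h3.1, (mem_horizontal_iff D).1 h3.2]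
    simp
  · rintro _ ⟨Φ, -, Ψ, -, h, rfl⟩
    refine ⟨?_, fun v hv => ?_⟩
    · have h0 : cx (mfderiv (endModel E) 𝓘(ℝ, E) (fun w : EndTotal E B => w.1) z)
          ((1 : ℂ) ⊗ₜ[ℝ] vertLift z Φ - Complex.I ⊗ₜ[ℝ] vertLift z Ψ) = 0 := by
        simp only [map_sub, cx, LinearMap.baseChange_tmul, ContinuousLinearMap.coe_coe,
          mfderiv_endProj_vertLift, TensorProduct.tmul_zero, sub_zero]
      rw [h0]
      exact zero_mem _
    · simp only [map_sub, reV_tmul, imV_tmul, Complex.one_re, Complex.one_im, Complex.I_re,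
        Complex.I_im, one_smul, zero_smul, sub_zero, zero_sub, map_neg, neg_apply,
        vertPart_vertLift]
      rw [h.apply_re hv, add_neg_cancel]

/-- Subtracting from `ζ` the vertical lift `η` of its vertical part leaves a vector of `𝒢₀`.
Vanishing on the conjugate of `q` is what makes `η` of type `(1,0)`; the tangency hypotheses keep
its components in the tangent space of the fibre. -/
theorem mem_distG' {z : EndTotal E B} {ζ : ℂ ⊗[ℝ] TangentSpace (endModel E) z}
    (h : ζ ∈ typeSubmodule D z) (h1 : vertPart D z (reV ζ) ∈ fibreTangent (c z.1) z.2)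
    (h2 : vertPart D z (imV ζ) ∈ fibreTangent (c z.1) z.2) : ζ ∈ distG' c D z := by
  obtain ⟨h3, h4⟩ := h
  let η : ℂ ⊗[ℝ] TangentSpace (endModel E) z :=
    (1 : ℂ) ⊗ₜ[ℝ] vertLift z (vertPart D z (reV ζ)) -
      Complex.I ⊗ₜ[ℝ] vertLift z (-vertPart D z (imV ζ))
  have h0 : cx (mfderiv (endModel E) 𝓘(ℝ, E) (fun w : EndTotal E B => w.1) z) η = 0 := by
    simp only [η, map_sub, cx, LinearMap.baseChange_tmul, ContinuousLinearMap.coe_coe,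
      mfderiv_endProj_vertLift, TensorProduct.tmul_zero, sub_zero]
  have hη : η ∈ vert10 c z := by
    refine Submodule.subset_span ⟨_, h1, _, fibreTangent_neg h2, isTimesI_of_apply h1 ?_, rfl⟩
    intro v hv
    rw [neg_apply]
    exact eq_neg_of_add_eq_zero_left (h4 v hv)
  have hre : reV η = vertLift z (vertPart D z (reV ζ)) := by simp [η]
  have him : imV η = - vertLift z (-vertPart D z (imV ζ)) := by simp [η]
  rw [← sub_add_cancel ζ η]
  refine Submodule.add_mem_sup ⟨?_, ?_⟩ hη
  · refine mem_baseChange_complex_iff.2 ⟨(mem_horizontal_iff D).2 ?_, (mem_horizontal_iff D).2 ?_⟩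
    · rw [map_sub, hre, map_sub, vertPart_vertLift, sub_self]
    · rw [map_sub, him, map_sub, map_neg, vertPart_vertLift, neg_neg, sub_self]
  · change cx (mfderiv (endModel E) 𝓘(ℝ, E) (fun w : EndTotal E B => w.1) z) (ζ - η) ∈ minusI z.2
    rw [map_sub, h0, sub_zero]
    exact h3

/-- The criterion of holomorphicity for fields of `f`-structures along a map. -/
theorem isHolomorphic_iff {E' : Type*} [NormedAddCommGroup E'] [NormedSpace ℝ E']
    {M : Type*} [TopologicalSpace M] [ChartedSpace E' M] {ι : M → B}
    {F : ∀ y : M, TangentSpace 𝓘(ℝ, E) (ι y) →L[ℝ] TangentSpace 𝓘(ℝ, E) (ι y)}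
    {J : ∀ y : M, TangentSpace 𝓘(ℝ, E') y →L[ℝ] TangentSpace 𝓘(ℝ, E') y}
    (hF : ∀ x, MDifferentiableAt 𝓘(ℝ, E') (endModel E) (fun y => (⟨ι y, F y⟩ : EndTotal E B)) x)
    (hfib : ∀ (x : M) (X : TangentSpace 𝓘(ℝ, E') x),
      endDeriv D ι F x X ∈ fibreTangent (c (ι x)) (F x))
    (hJF : ∀ x v, F x (dif E E' ι x v) = dif E E' ι x (J x v)) :
    IsHolomorphic (endModel E) J (fun y => (⟨ι y, F y⟩ : EndTotal E B)) (distG' c D) ↔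
      ∀ (x : M), ∀ Z ∈ minusI (J x), ∀ v ∈ minusI (F x),
        endDeriv D ι F x (reV Z) (reV v) + endDeriv D ι F x (imV Z) (imV v) = 0 := by
  constructor
  · intro h x Z hZ v hv
    have h1 := (distG'_le_typeSubmodule _ (h x (Submodule.mem_map_of_mem hZ))).2 v hv
    rwa [reV_cx, imV_cx, vertPart_mfderiv D (hF x), vertPart_mfderiv D (hF x)] at h1
  · rintro h x _ ⟨Z, hZ, rfl⟩
    refine mem_distG' ⟨?_, fun v hv => ?_⟩ ?_ ?_
    -- The section projects to `ι`, and `dι` intertwines `J` and `F`; hence the condition on the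
    -- projection always holds.
    · rw [mem_minusI, reV_cx, imV_cx, reV_cx, imV_cx, mfderiv_endProj_comp (hF x),
        mfderiv_endProj_comp (hF x)]
      have hZ' := mem_minusI.1 hZ
      exact ⟨by rw [hJF, hZ'.1], by rw [hJF, hZ'.2, map_neg]⟩
    · rw [reV_cx, imV_cx, vertPart_mfderiv D (hF x), vertPart_mfderiv D (hF x)]
      exact h x Z hZ v hv
    · rw [reV_cx, vertPart_mfderiv D (hF x)]
      exact hfib x _
    · rw [imV_cx, vertPart_mfderiv D (hF x)]
      exact hfib x _

end Holomorphic

/-! ### Covariant derivatives of f-structures are tangent to the fibres -/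

section Fibre

variable {E : Type*} [NormedAddCommGroup E] [NormedSpace ℝ E] [FiniteDimensional ℝ E]
  {B : Type*} [TopologicalSpace B] [ChartedSpace E B] [IsManifold 𝓘(ℝ, E) ∞ B]
  {E' : Type*} [NormedAddCommGroup E'] [NormedSpace ℝ E']
  {M : Type*} [TopologicalSpace M] [ChartedSpace E' M]

theorem mdifferentiableAt_extend_along {ι : M → B} {x : M}
    (hι : MDifferentiableAt 𝓘(ℝ, E') 𝓘(ℝ, E) ι x) (v : TangentSpace 𝓘(ℝ, E) (ι x)) :
    MDifferentiableAt 𝓘(ℝ, E') (𝓘(ℝ, E).prod 𝓘(ℝ, E))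
      (fun y => (⟨ι y, extend E v (ι y)⟩ : TangentBundle 𝓘(ℝ, E) B)) x :=
  (mdifferentiableAt_extend 𝓘(ℝ, E) E v).comp x hι

theorem pullbackDeriv_neg (D : CovariantDerivative 𝓘(ℝ, E) E (fun x : B => TangentSpace 𝓘(ℝ, E) x))
    {ι : M → B} {x : M} (hι : ContinuousAt ι x) (V : ∀ y : M, TangentSpace 𝓘(ℝ, E) (ι y))
    (X : TangentSpace 𝓘(ℝ, E') x) :
    pullbackDeriv D ι (fun y => -V y) x X = -pullbackDeriv D ι V x X := by
  rw [pullbackDeriv_eq D hι, pullbackDeriv_eq D hι]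
  have h : (fun y => crd (ι x) (ι y) (-V y)) = -fun y => crd (ι x) (ι y) (V y) := by
    ext y; simp
  rw [h, mvfderiv_neg]
  simp only [neg_apply, map_neg]
  abel

/-- The linearization of `F³ + F = 0`. -/
theorem endDeriv_cubic (D : CovariantDerivative 𝓘(ℝ, E) E (fun x : B => TangentSpace 𝓘(ℝ, E) x))
    {ι : M → B} {F : ∀ y : M, TangentSpace 𝓘(ℝ, E) (ι y) →L[ℝ] TangentSpace 𝓘(ℝ, E) (ι y)} {x : M}
    (hF : MDifferentiableAt 𝓘(ℝ, E') (endModel E) (fun y => (⟨ι y, F y⟩ : EndTotal E B)) x)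
    (hF3 : ∀ y v, F y (F y (F y v)) + F y v = 0) (X : TangentSpace 𝓘(ℝ, E') x)
    (v : TangentSpace 𝓘(ℝ, E) (ι x)) :
    F x (F x (endDeriv D ι F x X v)) + F x (endDeriv D ι F x X (F x v)) +
      endDeriv D ι F x X (F x (F x v)) + endDeriv D ι F x X v = 0 := by
  have hι : MDifferentiableAt 𝓘(ℝ, E') 𝓘(ℝ, E) ι x := (mdifferentiableAt_endTotal_iff.1 hF).1
  have hV := mdifferentiableAt_extend_along hι v
  have h1 := mdifferentiableAt_along_apply hF hV
  have h2 := mdifferentiableAt_along_apply hF h1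
  have e1 := pullbackDeriv_apply D hF hV X
  have e2 := pullbackDeriv_apply D hF h1 X
  have e3 := pullbackDeriv_apply D hF h2 X
  -- Differentiating `F³ V = -F V` by the Leibniz rule; the terms containing `D_X V` cancel by the
  -- cubic equation at `x`.
  have h4 : (fun y => F y (F y (F y (extend E v (ι y))))) = fun y => -F y (extend E v (ι y)) :=
    funext fun y => eq_neg_of_add_eq_zero_left (hF3 y _)
  rw [h4, pullbackDeriv_neg D hι.continuousAt, e2, e1] at e3
  simp only [extend_apply_self, map_add] at e3
  have h5 := hF3 x (pullbackDeriv D ι (fun y => extend E v (ι y)) x X)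
  rw [eq_neg_of_add_eq_zero_left h5] at e3
  rw [neg_eq_iff_add_eq_zero] at e3
  rw [← e3]
  abel

/-- A Riemannian metric in coordinates. -/
def metricCoord (g : ContMDiffRiemannianMetric 𝓘(ℝ, E) ∞ E (fun x : B => TangentSpace 𝓘(ℝ, E) x))
    (x y : B) : E →L[ℝ] E →L[ℝ] ℝ :=
  (trivializationAt (E →L[ℝ] E →L[ℝ] ℝ)
    (fun y : B => TangentSpace 𝓘(ℝ, E) y →L[ℝ] TangentSpace 𝓘(ℝ, E) y →L[ℝ] ℝ) x
    ⟨y, g.inner y⟩).2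

theorem metricCoord_apply
    (g : ContMDiffRiemannianMetric 𝓘(ℝ, E) ∞ E (fun x : B => TangentSpace 𝓘(ℝ, E) x))
    {x y : B} (hy : y ∈ crdSet (E := E) x) (u w : E) :
    metricCoord g x y u w = g.inner y (icrd x y u) (icrd x y w) := by
  have hy' : y ∈ (trivializationAt (E →L[ℝ] ℝ)
      (fun y : B => TangentSpace 𝓘(ℝ, E) y →L[ℝ] ℝ) x).baseSet := ⟨hy, Set.mem_univ _⟩
  simp [metricCoord, hom_trivializationAt_apply, ContinuousLinearMap.inCoordinates, icrd,
    Trivialization.coe_linearMapAt_of_mem _ hy']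

theorem mdifferentiableAt_metricCoord
    (g : ContMDiffRiemannianMetric 𝓘(ℝ, E) ∞ E (fun x : B => TangentSpace 𝓘(ℝ, E) x)) (x : B) :
    MDifferentiableAt 𝓘(ℝ, E) 𝓘(ℝ, E →L[ℝ] E →L[ℝ] ℝ) (metricCoord g x) x :=
  (mdifferentiableAt_section _ (fun y => g.inner y)).1 (g.contMDiff.mdifferentiableAt (by simp))

theorem mvfderiv_apply_const {F₁ F₂ : Type*} [NormedAddCommGroup F₁] [NormedSpace ℝ F₁]
    [NormedAddCommGroup F₂] [NormedSpace ℝ F₂] {f : M → F₁ →L[ℝ] F₂} {x : M}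
    (hf : MDifferentiableAt 𝓘(ℝ, E') 𝓘(ℝ, F₁ →L[ℝ] F₂) f x) (u : F₁)
    (X : TangentSpace 𝓘(ℝ, E') x) :
    mvfderiv 𝓘(ℝ, E') (fun y => f y u) x X = mvfderiv 𝓘(ℝ, E') f x X u := by
  have h := mvfderiv_bilin (ContinuousLinearMap.id ℝ (F₁ →L[ℝ] F₂)) hf
    (mdifferentiableAt_const (c := u)) X
  rw [mvfderiv_const] at h
  simpa using h

/-- The derivative of a metric in the conformal class, in coordinates. -/
theorem exists_mvfderiv_metricCoord (S : WeylSpace E B)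
    (g : ContMDiffRiemannianMetric 𝓘(ℝ, E) ∞ E (fun x : B => TangentSpace 𝓘(ℝ, E) x))
    (hg : ∀ x, g.inner x ∈ S.conf x) (x : B) :
    ∃ α : TangentSpace 𝓘(ℝ, E) x → ℝ, ∀ X U W : TangentSpace 𝓘(ℝ, E) x,
      mvfderiv 𝓘(ℝ, E) (metricCoord g x) x X (crd x x U) (crd x x W) =
        α X * g.inner x U W + g.inner x (christoffel S.conn x X U) W +
          g.inner x U (christoffel S.conn x X W) := by
  obtain ⟨α, hα⟩ := S.conformal g hg
  refine ⟨α x, fun X U W => ?_⟩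
  have h := hα x (extend E U) (extend E W) X (mdifferentiableAt_extend 𝓘(ℝ, E) E U)
    (mdifferentiableAt_extend 𝓘(ℝ, E) E W)
  have h1 : (fun y => g.inner y (extend E U y) (extend E W y)) =ᶠ[𝓝 x]
      fun y => metricCoord g x y (crd x x U) (crd x x W) := by
    filter_upwards [crdSet_mem_nhds (E := E) x] with y hy
    rw [metricCoord_apply g hy, extend_eq_icrd hy, extend_eq_icrd hy]
  have hd := mdifferentiableAt_metricCoord g x
  have hd' : MDifferentiableAt 𝓘(ℝ, E) 𝓘(ℝ, E →L[ℝ] ℝ)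
      (fun y => metricCoord g x y (crd x x U)) x := hd.clm_apply mdifferentiableAt_const
  rw [mvfderiv_congr_of_eventuallyEq h1, mvfderiv_apply_const hd', mvfderiv_apply_const hd,
    extend_apply_self, extend_apply_self] at h
  exact h

set_option synthInstance.maxHeartbeats 200000 in
/-- The covariant derivative of a skew-adjoint endomorphism is skew-adjoint. -/
theorem isSkew_endDeriv (S : WeylSpace E B) {ι : M → B}
    {F : ∀ y : M, TangentSpace 𝓘(ℝ, E) (ι y) →L[ℝ] TangentSpace 𝓘(ℝ, E) (ι y)} {x : M}
    (hF : MDifferentiableAt 𝓘(ℝ, E') (endModel E) (fun y => (⟨ι y, F y⟩ : EndTotal E B)) x)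
    (hskew : ∀ y, IsSkew (S.conf (ι y)) (F y)) (X : TangentSpace 𝓘(ℝ, E') x) :
    IsSkew (S.conf (ι x)) (endDeriv S.conn ι F x X) := by
  obtain ⟨g, hg⟩ := S.exists_metric
  have hgc : ∀ y, g.inner y ∈ S.conf y := fun y => by
    rw [hg]
    exact ⟨1, one_pos, (one_smul _ _).symm⟩
  suffices h : ∀ U W, g.inner (ι x) (endDeriv S.conn ι F x X U) W +
      g.inner (ι x) U (endDeriv S.conn ι F x X W) = 0 by
    intro b hb U W
    rw [hg] at hb
    obtain ⟨t, -, rfl⟩ := hb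
    simp only [smul_apply, smul_eq_mul]
    rw [← mul_add, h, mul_zero]
  intro U W
  obtain ⟨hι, hG⟩ := mdifferentiableAt_endTotal_iff.1 hF
  obtain ⟨α, hα⟩ := exists_mvfderiv_metricCoord S g hgc (ι x)
  set u := crd (ι x) (ι x) U with hu
  set w := crd (ι x) (ι x) W with hw
  set G : M → E →L[ℝ] E := fun y => endCoord (ι x) (⟨ι y, F y⟩ : EndTotal E B) with hGdef
  have hh := (mdifferentiableAt_metricCoord g (ι x)).comp x hι
  have hhd : ∀ X, mvfderiv 𝓘(ℝ, E') (metricCoord g (ι x) ∘ ι) x X =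
      mvfderiv 𝓘(ℝ, E) (metricCoord g (ι x)) (ι x) (dif E E' ι x X) := fun X =>
    mfderiv_comp_apply x (mdifferentiableAt_metricCoord g (ι x)) hι X
  have hGd : ∀ u, MDifferentiableAt 𝓘(ℝ, E') 𝓘(ℝ, E) (fun y => G y u) x := fun u =>
    hG.clm_apply mdifferentiableAt_const
  have hmem : ∀ᶠ y in 𝓝 x, ι y ∈ crdSet (E := E) (ι x) :=
    hι.continuousAt (crdSet_mem_nhds (E := E) (ι x))
  have hA : MDifferentiableAt 𝓘(ℝ, E') 𝓘(ℝ, E →L[ℝ] ℝ)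
      (fun y => (metricCoord g (ι x) ∘ ι) y (G y u)) x := hh.clm_apply (hGd u)
  have hB : MDifferentiableAt 𝓘(ℝ, E') 𝓘(ℝ, E →L[ℝ] ℝ)
      (fun y => (metricCoord g (ι x) ∘ ι) y u) x := hh.clm_apply mdifferentiableAt_const
  -- Skewness of `F` in coordinates: a function vanishing near `x`, whose derivative along `X` is
  -- expanded below by the product rule.
  have hk : (fun y => (metricCoord g (ι x) ∘ ι) y (G y u) w) +
      (fun y => (metricCoord g (ι x) ∘ ι) y u (G y w)) =ᶠ[𝓝 x] fun _ => (0 : ℝ) := by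
    filter_upwards [hmem] with y hy
    have h := hskew y _ (hgc (ι y)) (icrd (ι x) (ι y) u) (icrd (ι x) (ι y) w)
    simp only [Pi.add_apply, Function.comp_apply, metricCoord_apply g hy, hGdef, endCoord,
      ContinuousLinearMap.comp_apply, icrd_crd hy]
    exact h
  have hk' := congrArg (fun L : TangentSpace 𝓘(ℝ, E') x →L[ℝ] ℝ => L X)
    (mvfderiv_congr_of_eventuallyEq (E' := E') hk)
  have e1 : mvfderiv 𝓘(ℝ, E') (fun y => (metricCoord g (ι x) ∘ ι) y (G y u)) x X =
      mvfderiv 𝓘(ℝ, E') (metricCoord g (ι x) ∘ ι) x X (G x u) +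
        metricCoord g (ι x) (ι x) (mvfderiv 𝓘(ℝ, E') G x X u) := by
    have h := mvfderiv_bilin (ContinuousLinearMap.id ℝ (E →L[ℝ] E →L[ℝ] ℝ)) hh (hGd u) X
    rw [mvfderiv_apply_const hG] at h
    exact h
  have e2 : mvfderiv 𝓘(ℝ, E') (fun y => (metricCoord g (ι x) ∘ ι) y u (G y w)) x X =
      mvfderiv 𝓘(ℝ, E') (metricCoord g (ι x) ∘ ι) x X u (G x w) +
        metricCoord g (ι x) (ι x) u (mvfderiv 𝓘(ℝ, E') G x X w) := by
    have h := mvfderiv_bilin (ContinuousLinearMap.id ℝ (E →L[ℝ] ℝ)) hB (hGd w) X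
    rw [mvfderiv_apply_const hG, mvfderiv_apply_const hh] at h
    exact h
  rw [mvfderiv_add (hA.clm_apply mdifferentiableAt_const) (hB.clm_apply (hGd w)), mvfderiv_const,
    add_apply, mvfderiv_apply_const hA, e1, e2] at hk'
  have hGx : ∀ V, G x (crd (ι x) (ι x) V) = crd (ι x) (ι x) (F x V) := fun V => by
    simp [hGdef, endCoord]
  simp only [add_apply, hhd, hu, hw, hGx, hα, metricCoord_apply g (mem_crdSet (ι x)),
    icrd_crd_self, zero_apply] at hk'
  have s1 := hskew x _ (hgc (ι x)) U W
  have s2 := hskew x _ (hgc (ι x)) U (christoffel S.conn (ι x) (dif E E' ι x X) W)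
  have s3 := hskew x _ (hgc (ι x)) (christoffel S.conn (ι x) (dif E E' ι x X) U) W
  simp only [endDeriv, add_apply, sub_apply, ContinuousLinearMap.comp_apply, map_add, map_sub]
  -- The form `α` only multiplies the skewness relation of `F` at `x`, so conformality of `D` is as
  -- good as metricity; `s2` and `s3` absorb the Christoffel terms in which `F` and `Γ` act on
  -- different arguments.
  linear_combination hk' - α (dif E E' ι x X) * s1 - s2 - s3

theorem endDeriv_mem_fibreTangent (S : WeylSpace E B) {ι : M → B}
    {F : ∀ y : M, TangentSpace 𝓘(ℝ, E) (ι y) →L[ℝ] TangentSpace 𝓘(ℝ, E) (ι y)} {x : M}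
    (hF : MDifferentiableAt 𝓘(ℝ, E') (endModel E) (fun y => (⟨ι y, F y⟩ : EndTotal E B)) x)
    (hskew : ∀ y, IsSkew (S.conf (ι y)) (F y)) (hF3 : ∀ y v, F y (F y (F y v)) + F y v = 0)
    (X : TangentSpace 𝓘(ℝ, E') x) :
    endDeriv S.conn ι F x X ∈ fibreTangent (S.conf (ι x)) (F x) :=
  mem_fibreTangent_of_isSkew (hskew x) (isSkew_endDeriv S hF hskew X) (hF3 x)
    (endDeriv_cubic S.conn hF hF3 X)

end Fibre

/-! ### Complex structures and their eigenspaces -/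

section LinearAlgebra

variable {V W : Type*} [AddCommGroup V] [Module ℝ V] [TopologicalSpace V]

/-- A skew-adjoint `f`-structure whose eigenspaces have maximal dimension is a complex
structure. -/
theorem apply_apply_of_finrank_minusI [FiniteDimensional ℝ V] {J : V →L[ℝ] V}
    (h : Module.finrank ℝ V = 2 * Module.finrank ℂ (minusI J)) (v : V) : J (J v) = -v := by
  -- The real part determines an eigenvector, its imaginary part being `J` of it. By the dimension
  -- hypothesis each `v` is then the real part of an eigenvector, and on such vectors `J² = -1`.
  let ρ : minusI J →ₗ[ℝ] V := reV ∘ₗ ((minusI J).restrictScalars ℝ).subtype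
  have hρ : Function.Injective ρ := by
    rw [injective_iff_map_eq_zero]
    rintro ⟨z, hz⟩ h0
    have h0' : reV z = 0 := h0
    have h1 := (mem_minusI.1 hz).1
    rw [h0', map_zero] at h1
    exact Subtype.ext (ext_reV_imV (by simpa using h0') (by simpa using h1.symm))
  have hfr : Module.finrank ℝ (minusI J) = Module.finrank ℝ V := by
    rw [← Module.finrank_mul_finrank ℝ ℂ (minusI J), Complex.finrank_real_complex, h]
  have : FiniteDimensional ℝ (ℂ ⊗[ℝ] V) := inferInstance
  have : FiniteDimensional ℝ (minusI J) :=
    inferInstanceAs (FiniteDimensional ℝ ((minusI J).restrictScalars ℝ))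
  obtain ⟨z, hz⟩ := (LinearMap.injective_iff_surjective_of_finrank_eq_finrank hfr).1 hρ v
  have hz' : reV (z : ℂ ⊗[ℝ] V) = v := hz
  have h1 := mem_minusI.1 z.2
  rw [← hz', h1.1, h1.2]

theorem tmul_add_mem_minusI {J : V →L[ℝ] V} (hJ : ∀ v, J (J v) = -v) (v : V) :
    (1 : ℂ) ⊗ₜ[ℝ] v + Complex.I ⊗ₜ[ℝ] J v ∈ minusI J := by
  rw [mem_minusI]
  simp [hJ]

/-- The eigenvectors are exactly the vectors `X + i JX`, with `X` real and arbitrary. -/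
theorem forall_minusI_iff [AddCommGroup W] {J : V →L[ℝ] V} (hJ : ∀ v, J (J v) = -v)
    (Q : V → V → W) :
    (∀ Z ∈ minusI J, ∀ v ∈ minusI J, Q (reV Z) (reV v) + Q (imV Z) (imV v) = 0) ↔
      ∀ X Y, Q X Y + Q (J X) (J Y) = 0 := by
  constructor
  · intro h X Y
    simpa using h _ (tmul_add_mem_minusI hJ X) _ (tmul_add_mem_minusI hJ Y)
  · intro h Z hZ v hv
    rw [← (mem_minusI.1 hZ).1, ← (mem_minusI.1 hv).1]
    exact h _ _

end LinearAlgebra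

/-! ### Submanifolds and the Gauss formula -/

section Submanifolds

variable {E : Type*} [NormedAddCommGroup E] [NormedSpace ℝ E] [FiniteDimensional ℝ E]
  {N : Type*} [TopologicalSpace N] [ChartedSpace E N] [IsManifold 𝓘(ℝ, E) ∞ N]
  {E' : Type*} [NormedAddCommGroup E'] [NormedSpace ℝ E'] [FiniteDimensional ℝ E']
  {M : Type*} [TopologicalSpace M] [ChartedSpace E' M] [IsManifold 𝓘(ℝ, E') ∞ M]
  {S : WeylSpace E N} {ι : M → N} (hι : IsSubmanifold E E' ι)

theorem isConformalClass_inducedConf (hι : IsSubmanifold E E' ι) (S : WeylSpace E N) (x : M) :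
    IsConformalClass (inducedConf (E' := E') S.conf ι x) := by
  obtain ⟨g, hs, hp, hc⟩ := S.isConformalClass (ι x)
  let L := dif E E' ι x
  let g' : TangentSpace 𝓘(ℝ, E') x →L[ℝ] TangentSpace 𝓘(ℝ, E') x →L[ℝ] ℝ :=
    LinearMap.toContinuousLinearMap
      { toFun := fun v => g (L v) ∘L L
        map_add' := fun v w => by ext u; simp
        map_smul' := fun a v => by ext u; simp }
  have hg' : ∀ v w, g' v w = g (L v) (L w) := fun _ _ => rfl
  refine ⟨g', fun v w => hs _ _, fun v hv => hp _ fun h0 => hv ?_, ?_⟩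
  · exact hι.immersive x (h0.trans (map_zero L).symm)
  · ext b'
    constructor
    · rintro ⟨b, hb, h⟩
      rw [hc] at hb
      obtain ⟨t, ht, rfl⟩ := hb
      refine ⟨t, ht, ?_⟩
      ext v w
      exact h v w
    · rintro ⟨t, ht, rfl⟩
      exact ⟨t • g, by rw [hc]; exact ⟨t, ht, rfl⟩, fun v w => rfl⟩

theorem WeylSpace.symm_of_mem {x : N}
    {b : TangentSpace 𝓘(ℝ, E) x →L[ℝ] TangentSpace 𝓘(ℝ, E) x →L[ℝ] ℝ} (hb : b ∈ S.conf x)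
    (v w : TangentSpace 𝓘(ℝ, E) x) : b v w = b w v := by
  obtain ⟨g, hs, -, hc⟩ := S.isConformalClass x
  rw [hc] at hb
  obtain ⟨t, -, rfl⟩ := hb
  simp [hs v w]

theorem tangentialPart_dif (x : M) (u : TangentSpace 𝓘(ℝ, E') x) :
    tangentialPart S hι x (dif E E' ι x u) = u :=
  (exists_tangentialPart S hι x).choose_spec.1 u

theorem conf_sub_tangentialPart {x : M}
    {b : TangentSpace 𝓘(ℝ, E) (ι x) →L[ℝ] TangentSpace 𝓘(ℝ, E) (ι x) →L[ℝ] ℝ}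
    (hb : b ∈ S.conf (ι x)) (w : TangentSpace 𝓘(ℝ, E) (ι x)) (u : TangentSpace 𝓘(ℝ, E') x) :
    b (w - dif E E' ι x (tangentialPart S hι x w)) (dif E E' ι x u) = 0 :=
  (exists_tangentialPart S hι x).choose_spec.2 b hb w u

theorem conf_apply_dif {x : M}
    {b : TangentSpace 𝓘(ℝ, E) (ι x) →L[ℝ] TangentSpace 𝓘(ℝ, E) (ι x) →L[ℝ] ℝ}
    (hb : b ∈ S.conf (ι x)) (w : TangentSpace 𝓘(ℝ, E) (ι x)) (u : TangentSpace 𝓘(ℝ, E') x) :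
    b w (dif E E' ι x u) =
      b (dif E E' ι x (tangentialPart S hι x w)) (dif E E' ι x u) := by
  have h := conf_sub_tangentialPart hι hb w u
  rwa [map_sub, sub_apply, sub_eq_zero] at h

theorem conf_dif_apply {x : M}
    {b : TangentSpace 𝓘(ℝ, E) (ι x) →L[ℝ] TangentSpace 𝓘(ℝ, E) (ι x) →L[ℝ] ℝ}
    (hb : b ∈ S.conf (ι x)) (w : TangentSpace 𝓘(ℝ, E) (ι x)) (u : TangentSpace 𝓘(ℝ, E') x) :
    b (dif E E' ι x u) w =
      b (dif E E' ι x u) (dif E E' ι x (tangentialPart S hι x w)) := by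
  rw [WeylSpace.symm_of_mem hb, conf_apply_dif hι hb, WeylSpace.symm_of_mem hb]

/-- The normal part of `D_X (dι W)` depends only on the value of `W` at the given point. -/
theorem secondFundamentalForm_eq {W : ∀ y : M, TangentSpace 𝓘(ℝ, E') y} {x : M}
    (hW : MDiffAt (T% W) x) (X : TangentSpace 𝓘(ℝ, E') x) :
    secondFundamentalForm S hι x X (W x) =
      pullbackDeriv S.conn ι (fun y => dif E E' ι y (W y)) x X -
        dif E E' ι x (inducedConn S hι W x X) := by
  -- Multiplying `W` by `f` adds `X(f) dι W` to both terms, so the difference is tensorial.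
  have hT : TensorialAt 𝓘(ℝ, E') E' (fun W : ∀ y : M, TangentSpace 𝓘(ℝ, E') y =>
      pullbackDeriv S.conn ι (fun y => dif E E' ι y (W y)) x X -
        dif E E' ι x (inducedConn S hι W x X)) x := by
    constructor
    · intro f σ hf hσ
      rw [pullbackDeriv_smul hι S.conn hσ hf,
        (inducedConn S hι).isCovariantDerivativeOnUniv.leibniz hσ hf]
      simp only [add_apply, smul_apply, ContinuousLinearMap.smulRight_apply, map_add, map_smul,
        smul_sub]
      abel
    · intro σ τ hσ hτ
      rw [pullbackDeriv_add hι S.conn hσ hτ,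
        (inducedConn S hι).isCovariantDerivativeOnUniv.add hσ hτ]
      simp only [add_apply, map_add]
      abel
  exact hT.pointwise (mdifferentiableAt_extend 𝓘(ℝ, E') E' (W x)) hW (by simp)

theorem tangentialPart_secondFundamentalForm (x : M) (X Y : TangentSpace 𝓘(ℝ, E') x) :
    tangentialPart S hι x (secondFundamentalForm S hι x X Y) = 0 := by
  rw [secondFundamentalForm, map_sub, tangentialPart_dif]
  exact sub_self _

/-- The endomorphisms of `TM` induced by a differentiable field of endomorphisms of `TN`, along
`M`, which preserves `TM`, form a differentiable field. -/
theorem mdifferentiableAt_end_of_intertwining (hι : IsSubmanifold E E' ι)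
    {F : ∀ y : M, TangentSpace 𝓘(ℝ, E) (ι y) →L[ℝ] TangentSpace 𝓘(ℝ, E) (ι y)}
    {J : ∀ y : M, TangentSpace 𝓘(ℝ, E') y →L[ℝ] TangentSpace 𝓘(ℝ, E') y}
    (hJF : ∀ x v, F x (dif E E' ι x v) = dif E E' ι x (J x v)) {x : M}
    (hF : MDifferentiableAt 𝓘(ℝ, E') (endModel E) (fun y => (⟨ι y, F y⟩ : EndTotal E N)) x) :
    MDifferentiableAt 𝓘(ℝ, E') (endModel E') (fun y => (⟨y, J y⟩ : EndTotal E' M)) x := by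
  have hι' : MDifferentiableAt 𝓘(ℝ, E') 𝓘(ℝ, E) ι x := (mdifferentiableAt_endTotal_iff.1 hF).1
  have hG := (mdifferentiableAt_endTotal_iff.1 hF).2
  refine mdifferentiableAt_endTotal_iff.2 ⟨mdifferentiableAt_id, ?_⟩
  let A : M → E' →L[ℝ] E := fun y => crd (ι x) (ι y) ∘L dif E E' ι y ∘L icrd x y
  have hA : MDifferentiableAt 𝓘(ℝ, E') 𝓘(ℝ, E' →L[ℝ] E) A x :=
    ((hι.smooth.contMDiffAt (x := x)).mfderiv_const (m := 1) (by norm_cast)).mdifferentiableAt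
      one_ne_zero
  let G : M → E →L[ℝ] E := fun y => endCoord (ι x) (⟨ι y, F y⟩ : EndTotal E N)
  -- In coordinates the intertwining reads `G A = A j`, with `A` the differential of `ι` and `j` the
  -- coordinates of `J`. A left inverse `P` of `A x` makes `K = P A` invertible near `x`, so `j =
  -- K⁻¹ P G A` is differentiable.
  obtain ⟨P, hP⟩ : ∃ P : E →L[ℝ] E', P ∘L A x = 1 := by
    have hinj : LinearMap.ker (A x).toLinearMap = ⊥ := by
      rw [LinearMap.ker_eq_bot]
      intro u v huv
      have h1 := congrArg (icrd (ι x) (ι x)) huv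
      simp only [A, ContinuousLinearMap.coe_coe, ContinuousLinearMap.comp_apply,
        icrd_crd_self] at h1
      have h2 := congrArg (crd x x) (hι.immersive x h1)
      simpa using h2
    obtain ⟨P, hP⟩ := (A x).toLinearMap.exists_leftInverse_of_injective hinj
    refine ⟨LinearMap.toContinuousLinearMap P, ?_⟩
    ext u
    exact LinearMap.congr_fun hP u
  let K : M → E' →L[ℝ] E' := fun y => P ∘L A y
  have hK : MDifferentiableAt 𝓘(ℝ, E') 𝓘(ℝ, E' →L[ℝ] E') K x :=
    mdifferentiableAt_const.clm_comp hA
  have hKx : K x = ((1 : (E' →L[ℝ] E')ˣ) : E' →L[ℝ] E') := hP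
  have : CompleteSpace E' := FiniteDimensional.complete ℝ E'
  have hinv : DifferentiableAt ℝ (Ring.inverse : (E' →L[ℝ] E') → E' →L[ℝ] E') (K x) := by
    rw [hKx]
    exact differentiableAt_inverse isUnit_one
  have hKi : MDifferentiableAt 𝓘(ℝ, E') 𝓘(ℝ, E' →L[ℝ] E') (fun y => Ring.inverse (K y)) x :=
    hinv.mdifferentiableAt.comp x hK
  have hres : MDifferentiableAt 𝓘(ℝ, E') 𝓘(ℝ, E' →L[ℝ] E')
      (fun y => Ring.inverse (K y) ∘L (P ∘L (G y ∘L A y))) x :=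
    hKi.clm_comp (mdifferentiableAt_const.clm_comp (hG.clm_comp hA))
  refine hres.congr_of_eventuallyEq ?_
  have hunit : ∀ᶠ y in 𝓝 x, IsUnit (K y) := by
    refine hK.continuousAt.eventually ?_
    rw [hKx]
    exact Units.nhds _
  filter_upwards [hunit, crdSet_mem_nhds (E := E') x,
    hι'.continuousAt (crdSet_mem_nhds (E := E) (ι x))] with y hy hyx hyι
  have h1 : G y ∘L A y = A y ∘L endCoord x (⟨y, J y⟩ : EndTotal E' M) := by
    ext u
    simp only [G, A, endCoord, ContinuousLinearMap.comp_apply]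
    rw [icrd_crd hyι, icrd_crd hyx, hJF]
  have h2 : Ring.inverse (K y) * (K y * endCoord x (⟨y, J y⟩ : EndTotal E' M)) =
      endCoord x (⟨y, J y⟩ : EndTotal E' M) := by
    rw [← mul_assoc, Ring.inverse_mul_cancel _ hy, one_mul]
  rw [h1]
  exact h2.symm

/-- The Gauss formula for the covariant derivative of a field of endomorphisms `F` of `TN`, along
`M`, which is the extension by zero, on the normal bundle, of a field of endomorphisms `J` of
`TM`. -/
theorem endDeriv_dif
    {F : ∀ y : M, TangentSpace 𝓘(ℝ, E) (ι y) →L[ℝ] TangentSpace 𝓘(ℝ, E) (ι y)}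
    {J : ∀ y : M, TangentSpace 𝓘(ℝ, E') y →L[ℝ] TangentSpace 𝓘(ℝ, E') y}
    (hJF : ∀ x w, F x w = dif E E' ι x (J x (tangentialPart S hι x w))) {x : M}
    (hF : MDifferentiableAt 𝓘(ℝ, E') (endModel E) (fun y => (⟨ι y, F y⟩ : EndTotal E N)) x)
    (X Y : TangentSpace 𝓘(ℝ, E') x) :
    endDeriv S.conn ι F x X (dif E E' ι x Y) =
      dif E E' ι x (endDeriv (inducedConn S hι) (fun y : M => y) J x X Y) +
        secondFundamentalForm S hι x X (J x Y) := by
  have hJF' : ∀ x v, F x (dif E E' ι x v) = dif E E' ι x (J x v) := fun x v => by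
    rw [hJF, tangentialPart_dif]
  have hJ := mdifferentiableAt_end_of_intertwining hι hJF' hF
  have hY := mdifferentiableAt_extend 𝓘(ℝ, E') E' Y
  have hJY := mdifferentiableAt_along_apply hJ hY
  have e1 := pullbackDeriv_apply S.conn hF (mdifferentiableAt_dif hι hY) X
  have e2 := pullbackDeriv_apply (inducedConn S hι) hJ hY X
  have e3 := secondFundamentalForm_eq (S := S) hι hJY X
  rw [pullbackDeriv_id _ hJY, pullbackDeriv_id _ hY] at e2
  simp only [hJF', extend_apply_self] at e1 e2 e3
  -- `F` sees only the tangential part of `D_X (dι Y)`, which is `D^M_X Y` by definition; so the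
  -- terms `F (D_X (dι Y))` and `dι (J (D^M_X Y))` cancel.
  rw [e3, e1, e2, hJF x (pullbackDeriv _ _ _ _ _), map_add]
  have e4 : inducedConn S hι (extend E' Y) x X = tangentialPart S hι x
      (pullbackDeriv S.conn ι (fun y => dif E E' ι y (extend E' Y y)) x X) := rfl
  rw [e4]
  abel

end Submanifolds

/-! ### The equivalence -/

section Equivalence

variable {E : Type*} [NormedAddCommGroup E] [NormedSpace ℝ E] [FiniteDimensional ℝ E]
  {N : Type*} [TopologicalSpace N] [ChartedSpace E N] [IsManifold 𝓘(ℝ, E) ∞ N]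
  {E' : Type*} [NormedAddCommGroup E'] [NormedSpace ℝ E'] [FiniteDimensional ℝ E']
  {M : Type*} [TopologicalSpace M] [ChartedSpace E' M] [IsManifold 𝓘(ℝ, E') ∞ M]
  {S : WeylSpace E N} {ι : M → N} (hι : IsSubmanifold E E' ι)
  {p : ∀ x : M, Submodule ℂ (ℂ ⊗[ℝ] TangentSpace 𝓘(ℝ, E) (ι x))}

theorem isIsotropic_tangentPlane {x : M} (hp : IsIsotropic (S.conf (ι x)) (p x)) :
    IsIsotropic (inducedConf (E' := E') S.conf ι x) (tangentPlane E' p x) := by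
  rintro b' ⟨b, hb, h⟩ v hv w hw
  have h1 := hp b hb _ hv _ hw
  rw [baseChange_re_im] at h1 ⊢
  simpa only [reV_cx, imV_cx, h] using h1

theorem almostHermitian_spec (hι : IsSubmanifold E E' ι) {x : M}
    (hp : IsIsotropic (S.conf (ι x)) (p x)) :
    IsFStructureOf (inducedConf S.conf ι x) (tangentPlane E' p x) (almostHermitian E' S p x) :=
  fStructure_spec (isConformalClass_inducedConf hι S x) (isIsotropic_tangentPlane hp)

/-- The `f`-structure on `N` defined by an isotropic space `p` tangent to `M` is the extension,
by zero on the normal space, of `J^p`. -/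
theorem fStructure_eq_almostHermitian {x : M} (hp : IsIsotropic (S.conf (ι x)) (p x))
    (htan : p x ≤ LinearMap.range (cx (dif E E' ι x))) (w : TangentSpace 𝓘(ℝ, E) (ι x)) :
    fStructure (S.conf (ι x)) (p x) w =
      dif E E' ι x (almostHermitian E' S p x (tangentialPart S hι x w)) := by
  obtain ⟨h1, h2, h3⟩ := almostHermitian_spec hι hp
  set J := almostHermitian E' S p x with hJ
  set P := tangentialPart S hι x with hP
  set L := dif E E' ι x with hL
  have hPL : ∀ u, P (L u) = u := tangentialPart_dif hι x
  -- By uniqueness of the f-structure with eigenspace `p`, it suffices that `L J P` is one.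
  have hF : IsFStructureOf (S.conf (ι x)) (p x) (L ∘L J ∘L P) := by
    refine ⟨fun b hb v w => ?_, fun v => ?_, ?_⟩
    · have h := h1 (LinearMap.toContinuousLinearMap
        { toFun := fun v => b (L v) ∘L L
          map_add' := fun v w => by ext u; simp
          map_smul' := fun a v => by ext u; simp }) ⟨b, hb, fun _ _ => rfl⟩ (P v) (P w)
      change b (L (J (P v))) w + b v (L (J (P w))) = 0
      rw [conf_apply_dif hι hb, conf_dif_apply hι hb]
      exact h
    · simp only [ContinuousLinearMap.comp_apply, hPL]
      rw [← map_add, h2, map_zero]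
    · ext z
      rw [mem_minusI]
      simp only [ContinuousLinearMap.comp_apply]
      constructor
      · rintro ⟨e1, e2⟩
        -- An eigenvector for a nonzero eigenvalue lies in the image of `L J P`, hence is tangent to
        -- `M`; the preimage is read off from the eigenvalue equations.
        have hz : cx L ((1 : ℂ) ⊗ₜ[ℝ] (-J (P (imV z))) + Complex.I ⊗ₜ[ℝ] J (P (reV z))) = z := by
          apply ext_reV_imV
          · simp [reV_cx, e2]
          · simp [imV_cx, e1]
        rw [← hz]
        change _ ∈ tangentPlane E' p x
        rw [← h3, mem_minusI]
        have e3 : P (imV z) = J (P (reV z)) := by rw [← e1, hPL]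
        have e4 : P (reV z) = -J (P (imV z)) := by
          rw [← hPL (J (P (imV z))), e2, map_neg, neg_neg]
        simp only [map_add, reV_tmul, imV_tmul, Complex.one_re, Complex.one_im, Complex.I_re,
          Complex.I_im, one_smul, zero_smul, add_zero, zero_add]
        rw [← e4, ← e3, neg_eq_iff_eq_neg.1 e4.symm]
        simp
      · intro hz
        obtain ⟨u, rfl⟩ := htan hz
        have hu : u ∈ minusI J := by rw [h3]; exact hz
        rw [mem_minusI] at hu
        rw [reV_cx, imV_cx, hPL, hPL, hu.1, hu.2, map_neg]
        exact ⟨rfl, rfl⟩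
  have h := (existsUnique_isFStructureOf (S.isConformalClass (ι x)) hp).unique
    (fStructure_spec (S.isConformalClass (ι x)) hp) hF
  rw [h]
  rfl

/-- As `dim M` is twice the rank of `p`, the space `p` is maximal isotropic in the complexified
tangent space of `M`, which leaves no kernel for the f-structure `J^p`. -/
theorem almostHermitian_sq (hι : IsSubmanifold E E' ι) {x : M}
    (hp : IsIsotropic (S.conf (ι x)) (p x))
    (hfr : Module.finrank ℝ E' = 2 * Module.finrank ℂ (p x))
    (htan : p x ≤ LinearMap.range (cx (dif E E' ι x))) (v : TangentSpace 𝓘(ℝ, E') x) :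
    almostHermitian E' S p x (almostHermitian E' S p x v) = -v := by
  obtain ⟨-, -, h3⟩ := almostHermitian_spec hι hp
  refine apply_apply_of_finrank_minusI ?_ v
  have hinj : Function.Injective (cx (dif E E' ι x)) := by
    intro u v huv
    apply ext_reV_imV
    · apply hι.immersive x
      rw [← reV_cx, ← reV_cx, huv]
    · apply hι.immersive x
      rw [← imV_cx, ← imV_cx, huv]
  have hmap : (tangentPlane E' p x).map (cx (dif E E' ι x)) = p x := by
    rw [tangentPlane, Submodule.map_comap_eq, inf_eq_right.2 htan]
  rw [h3, (Submodule.equivMapOfInjective _ hinj (tangentPlane E' p x)).finrank_eq, hmap]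
  exact hfr

/-- The covariant derivative of `J^p` is tangent to the fibres of the bundle of isotropic
spaces of `M`. -/
theorem endDeriv_inducedConn_mem_fibreTangent
    {F : ∀ y : M, TangentSpace 𝓘(ℝ, E) (ι y) →L[ℝ] TangentSpace 𝓘(ℝ, E) (ι y)}
    {J : ∀ y : M, TangentSpace 𝓘(ℝ, E') y →L[ℝ] TangentSpace 𝓘(ℝ, E') y}
    (hJF : ∀ x w, F x w = dif E E' ι x (J x (tangentialPart S hι x w)))
    (hskew : ∀ y, IsSkew (S.conf (ι y)) (F y))
    (hskew' : ∀ y, IsSkew (inducedConf S.conf ι y) (J y))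
    (hJ3 : ∀ y v, J y (J y (J y v)) + J y v = 0) {x : M}
    (hF : MDifferentiableAt 𝓘(ℝ, E') (endModel E) (fun y => (⟨ι y, F y⟩ : EndTotal E N)) x)
    (hJ : MDifferentiableAt 𝓘(ℝ, E') (endModel E') (fun y => (⟨y, J y⟩ : EndTotal E' M)) x)
    (X : TangentSpace 𝓘(ℝ, E') x) :
    endDeriv (inducedConn S hι) (fun y : M => y) J x X ∈
      fibreTangent (inducedConf S.conf ι x) (J x) := by
  refine mem_fibreTangent_of_isSkew (hskew' x) ?_ (hJ3 x) (endDeriv_cubic _ hJ hJ3 X)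
  rintro b' ⟨b, hb, h⟩ v w
  -- Skewness is inherited from `D F`: by the Gauss formula, `D^M J` is the tangential part of its
  -- restriction to `TM`.
  have hn : ∀ u, tangentialPart S hι x (endDeriv S.conn ι F x X (dif E E' ι x u)) =
      endDeriv (inducedConn S hι) (fun y : M => y) J x X u := fun u => by
    rw [endDeriv_dif hι hJF hF, map_add, tangentialPart_dif,
      tangentialPart_secondFundamentalForm, add_zero]
  rw [h, h, ← hn, ← hn, ← conf_apply_dif hι hb, ← conf_dif_apply hι hb]
  exact isSkew_endDeriv S hF hskew X b hb _ _

/-- Both holomorphicity conditions become real tensor equations, for `T = D F` on `TM` and for `R =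
D^M J`; the Gauss formula identifies `R` with the tangential part of `T` and leaves the second
fundamental form as the normal part. -/
theorem isHolomorphic_iff_isOneOneGeodesic_and (hp : ∀ x, IsIsotropic (S.conf (ι x)) (p x))
    (hsm : ∀ x, MDifferentiableAt 𝓘(ℝ, E') (endModel E)
      (fun y => isoPoint S.conf (ι y) (p y)) x)
    (hfr : ∀ x, Module.finrank ℝ E' = 2 * Module.finrank ℂ (p x))
    (htan : ∀ x, p x ≤ LinearMap.range (cx (dif E E' ι x))) :
    IsHolomorphic (endModel E) (almostHermitian E' S p)
        (fun x => isoPoint S.conf (ι x) (p x)) (distG' S.conf S.conn) ↔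
      IsOneOneGeodesic S hι (almostHermitian E' S p) ∧
        IsHolomorphic (endModel E') (almostHermitian E' S p)
          (fun x => isoPoint (inducedConf S.conf ι) x (tangentPlane E' p x))
          (distG' (inducedConf S.conf ι) (inducedConn S hι)) := by
  let F : ∀ y : M, TangentSpace 𝓘(ℝ, E) (ι y) →L[ℝ] TangentSpace 𝓘(ℝ, E) (ι y) :=
    fun y => fStructure (S.conf (ι y)) (p y)
  let J := almostHermitian E' S p
  have hFs : ∀ y, IsFStructureOf (S.conf (ι y)) (p y) (F y) := fun y =>
    fStructure_spec (S.isConformalClass (ι y)) (hp y)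
  have hJs : ∀ y, IsFStructureOf (inducedConf S.conf ι y) (tangentPlane E' p y) (J y) := fun y =>
    almostHermitian_spec hι (hp y)
  have hJF : ∀ x w, F x w = dif E E' ι x (J x (tangentialPart S hι x w)) := fun x w =>
    fStructure_eq_almostHermitian hι (hp x) (htan x) w
  have hJF' : ∀ x v, F x (dif E E' ι x v) = dif E E' ι x (J x v) := fun x v => by
    rw [hJF, tangentialPart_dif]
  have hJ2 : ∀ x v, J x (J x v) = -v := fun x v =>
    almostHermitian_sq hι (hp x) (hfr x) (htan x) v
  have hJd : ∀ x, MDifferentiableAt 𝓘(ℝ, E') (endModel E') (fun y => (⟨y, J y⟩ : EndTotal E' M)) x :=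
    fun x => mdifferentiableAt_end_of_intertwining hι hJF' (hsm x)
  let T := fun x => endDeriv (E' := E') S.conn ι F x
  let R := fun x => endDeriv (E' := E') (M := M) (inducedConn S hι) (fun y : M => y) J x
  have hTR : ∀ x X Y, T x X (dif E E' ι x Y) =
      dif E E' ι x (R x X Y) + secondFundamentalForm S hι x X (J x Y) := fun x X Y =>
    endDeriv_dif hι hJF (hsm x) X Y
  have hN : IsHolomorphic (endModel E) J (fun x => isoPoint S.conf (ι x) (p x))
      (distG' S.conf S.conn) ↔ ∀ x (X Y : TangentSpace 𝓘(ℝ, E') x),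
        T x X (dif E E' ι x Y) + T x (J x X) (dif E E' ι x (J x Y)) = 0 := by
    refine (isHolomorphic_iff hsm (fun x X => endDeriv_mem_fibreTangent S (hsm x)
      (fun y => (hFs y).1) (fun y => (hFs y).2.1) X) hJF').trans (forall_congr' fun x => ?_)
    rw [← forall_minusI_iff (hJ2 x) fun X Y => T x X (dif E E' ι x Y)]
    -- As `p` is tangent to `M`, the complexified `dι` maps the eigenspace of `J` onto that of `F`,
    -- so testing on vectors tangent to `M` is enough.
    refine forall₂_congr fun Z _ => ⟨fun h v hv => ?_, fun h v hv => ?_⟩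
    · have hv' : cx (dif E E' ι x) v ∈ minusI (F x) := by
        rw [(hFs x).2.2]
        rw [(hJs x).2.2] at hv
        exact hv
      have := h _ hv'
      rwa [reV_cx, imV_cx] at this
    · rw [(hFs x).2.2] at hv
      obtain ⟨u, rfl⟩ := htan x hv
      have hu : u ∈ minusI (J x) := by
        rw [(hJs x).2.2]
        exact hv
      rw [reV_cx, imV_cx]
      exact h u hu
  have hM : IsHolomorphic (endModel E') J
      (fun x => isoPoint (inducedConf S.conf ι) x (tangentPlane E' p x))
      (distG' (inducedConf S.conf ι) (inducedConn S hι)) ↔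
        ∀ x (X Y : TangentSpace 𝓘(ℝ, E') x), R x X Y + R x (J x X) (J x Y) = 0 := by
    refine (isHolomorphic_iff (ι := fun y : M => y) hJd
      (fun x X => endDeriv_inducedConn_mem_fibreTangent hι hJF
      (fun y => (hFs y).1) (fun y => (hJs y).1) (fun y => (hJs y).2.1) (hsm x) (hJd x) X)
      (fun x v => by rw [dif_id, dif_id])).trans (forall_congr' fun x => ?_)
    exact forall_minusI_iff (hJ2 x) fun X Y => R x X Y
  have hsum : ∀ x (X Y : TangentSpace 𝓘(ℝ, E') x),
      T x X (dif E E' ι x Y) + T x (J x X) (dif E E' ι x (J x Y)) =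
        dif E E' ι x (R x X Y + R x (J x X) (J x Y)) +
          (secondFundamentalForm S hι x X (J x Y) +
            secondFundamentalForm S hι x (J x X) (J x (J x Y))) := fun x X Y => by
    rw [hTR, hTR, map_add]
    abel
  refine hN.trans (Iff.trans ?_ (and_congr_right fun _ => hM.symm))
  constructor
  · intro h
    have hR : ∀ x (X Y : TangentSpace 𝓘(ℝ, E') x), R x X Y + R x (J x X) (J x Y) = 0 := by
      intro x X Y
      -- The second fundamental form is normal, so the tangential part isolates `R`.
      have h1 := congrArg (tangentialPart S hι x) ((hsum x X Y).symm.trans (h x X Y))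
      simpa only [map_add (tangentialPart S hι x), tangentialPart_dif,
        tangentialPart_secondFundamentalForm, add_zero, map_zero] using h1
    refine ⟨fun x X Y => ?_, hR⟩
    -- Replacing `Y` by `-JY` turns `b(X, JY)` into `b(X, Y)` and `b(JX, J²Y)` into `b(JX, JY)`.
    have h1 := (hsum x X (-J x Y)).symm.trans (h x X (-J x Y))
    rw [hR, map_zero, zero_add, map_neg, hJ2, neg_neg] at h1
    exact (congrArg _ h1).trans (smul_zero _)
  · rintro ⟨hb, hR⟩ x X Y
    rw [hsum, hR, map_zero, zero_add]
    have h1 := hb x X (J x Y)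
    rwa [smul_eq_zero_iff_right (by norm_num)] at h1

end Equivalence
end WeylTwistor

end

theorem proposition4p2 {n r : ℕ} (hr : 1 ≤ r) (hrn : 2 * r < n)
    {N : Type*} [TopologicalSpace N] [T2Space N] [SigmaCompactSpace N]
    [ChartedSpace (EuclideanSpace ℝ (Fin n)) N] [IsManifold (𝓡 n) ∞ N]
    {M : Type*} [TopologicalSpace M] [T2Space M] [SigmaCompactSpace M]
    [ChartedSpace (EuclideanSpace ℝ (Fin (2 * r))) M] [IsManifold (𝓡 (2 * r)) ∞ M]
    (S : WeylTwistor.WeylSpace (EuclideanSpace ℝ (Fin n)) N)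
    (ι : M → N)
    (hι : WeylTwistor.IsSubmanifold (EuclideanSpace ℝ (Fin n))
      (EuclideanSpace ℝ (Fin (2 * r))) ι)
    (p : ∀ x : M, Submodule ℂ (ℂ ⊗[ℝ] TangentSpace (𝓡 n) (ι x)))
    (hp : WeylTwistor.IsIsotropicSection S (EuclideanSpace ℝ (Fin (2 * r))) ι r p)
    (htan : ∀ x, p x ≤ LinearMap.range (WeylTwistor.cx (mfderiv (𝓡 (2 * r)) (𝓡 n) ι x)))
    (o : ∀ x : M, Orientation ℝ (TangentSpace (𝓡 (2 * r)) x) (Fin (2 * r)))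
    (ho : WeylTwistor.IsOrientation (EuclideanSpace ℝ (Fin (2 * r))) o)
    (hpos : ∀ x, WeylTwistor.IsPositive (o x)
      (WeylTwistor.almostHermitian (EuclideanSpace ℝ (Fin (2 * r))) S p x)) :
    WeylTwistor.IsHolomorphic
        (WeylTwistor.endModel (EuclideanSpace ℝ (Fin n)))
        (WeylTwistor.almostHermitian (EuclideanSpace ℝ (Fin (2 * r))) S p)
        (fun x => WeylTwistor.isoPoint S.conf (ι x) (p x))
        (WeylTwistor.distG' S.conf S.conn) ↔
      WeylTwistor.IsOneOneGeodesic S hι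
          (WeylTwistor.almostHermitian (EuclideanSpace ℝ (Fin (2 * r))) S p) ∧
        WeylTwistor.IsHolomorphic
          (WeylTwistor.endModel (EuclideanSpace ℝ (Fin (2 * r))))
          (WeylTwistor.almostHermitian (EuclideanSpace ℝ (Fin (2 * r))) S p)
          (fun x => WeylTwistor.isoPoint (WeylTwistor.inducedConf S.conf ι) x
            (WeylTwistor.tangentPlane (EuclideanSpace ℝ (Fin (2 * r))) p x))
          (WeylTwistor.distG' (WeylTwistor.inducedConf S.conf ι)
            (WeylTwistor.inducedConn S hι)) := by
  refine WeylTwistor.isHolomorphic_iff_isOneOneGeodesic_and hι hp.isotropic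
    (fun x => (hp.smooth x).mdifferentiableAt (by simp)) (fun x => ?_) htan
  -- `dim M = 2r` and `p` has rank `r`: the maximality of `p` in the complexified tangent space of
  -- `M`.
  rw [hp.finrank x, finrank_euclideanSpace_fin]
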